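/- Let $k\ge 3$ be an integer. The harmonic function $f_k:[0,1]\to[0,1]$ is defined by $f_k(x)=1/q$ for $x\in(\frac1{q+1},\frac1q]$, $q\in\{1,\dots,k-1\}$, and $f_k(x)=\frac{k}{k-2}x$ for $x\le\frac1k$. A function $g:[0,1]\to[0,1]$ is a weighting function if $\sum_{i=1}^m g(x_i)\le 1$ for all $m\ge 1$ and all $x\in[0,1]^m$ with $\sum_{i=1}^m x_i\le 1$. Let $T_k$ be the smallest positive constant such that $f_k/T_k$ is a weighting function. Let $d\ge 2$ and let $I$ be a finite collection of $d$-dimensional axis-parallel boxes (items), item $i$ having side lengths $\ell_1(i),\dots,\ell_d(i)\in(0,1]$. Let $\mathrm{opt}_{d\mathrm{BP}}(I)$ be the minimum number of $d$-dimensional unit cubes into which $I$ can be packed by translations, without rotation and without overlap. Let $\mathrm{round}(I)$ be the collection of rectangles obtained by replacing each item $i$ by a rectangle of width $\prod_{j=1}^{d-1}f_k(\ell_j(i))$ and height $\ell_d(i)$. Let $\delta\in(0,1)$ and let $K$ be a finite collection of rectangles. A rectangle of $K$ is $\delta$-large if its height exceeds $\delta$, and $\delta$-small otherwise. A shelf is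 a rectangle of width $1$. A shelf-based $\delta$-fractional packing of $K$ into $N$ bins (unit squares) consists of finitely many shelves packed into the bins without overlap, together with a non-overlapping axis-parallel packing (without rotation) of all of $K$ into the bins, where each $\delta$-large rectangle may first be cut recursively (finitely often) by vertical cuts, each $\delta$-small rectangle may first be cut recursively (finitely often) by vertical and horizontal cuts, every slice of a $\delta$-large rectangle lies inside a shelf with its bottom edge on the bottom edge of the shelf, and no slice of a $\delta$-small rectangle overlaps a shelf. The packing is structured if its shelves have at most $\lceil 1/\delta^2\rceil$ distinct heights and each shelf height is the height of some $\delta$-large rectangle of $K$. Let $\mathrm{sopt}_\delta(K)$ be the minimum number of bins in a structured $\delta$-fractional packing of $K$. Then $\mathrm{round}(I)$ has a structured $\delta$-fractional packing, and $$\mathrm{sopt}_\delta(\mathrm{round}(I)) < T_k^{d-1}(1+\delta)\,\mathrm{opt}_{d\mathrm{BP}}(I)+\lceil 1/\delta^2\rceil+1+\delta .$$ -/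

import Mathlib

/-! ### Harmonic rounding and weighting functions -/

/-- The harmonic function `f_k`: on `[0, 1]` it is `k / (k - 2) * x` for `x ≤ 1 / k`, and it is
`1 / q` on `(1 / (q + 1), 1 / q]` for `q = 1, …, k - 1` (there `⌊1 / x⌋ = q`). -/
noncomputable def harmonicFn (k : ℕ) (x : ℝ) : ℝ :=
  if x ≤ 1 / (k : ℝ) then (k : ℝ) / ((k : ℝ) - 2) * x else 1 / (⌊1 / x⌋₊ : ℝ)

theorem harmonicFn_of_mem_Ioc {k q : ℕ} (hq : 1 ≤ q) (hqk : q < k) {x : ℝ}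
    (hx : x ∈ Set.Ioc (1 / ((q : ℝ) + 1)) (1 / (q : ℝ))) : harmonicFn k x = 1 / (q : ℝ) := by
  have hq0 : (0 : ℝ) < q := by exact_mod_cast hq
  have hx0 : 0 < x := lt_trans (by positivity) hx.1
  have hkx : 1 / (k : ℝ) < x := by
    refine lt_of_le_of_lt ?_ hx.1
    have h : (q : ℝ) + 1 ≤ k := by exact_mod_cast hqk
    exact one_div_le_one_div_of_le (by positivity) h
  have hfl : ⌊1 / x⌋₊ = q := by
    rw [Nat.floor_eq_iff (by positivity)]
    constructor
    · rw [le_div_iff₀ hx0]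
      have := hx.2
      rw [le_div_iff₀ hq0] at this
      linarith
    · rw [div_lt_iff₀ hx0]
      have := hx.1
      rw [div_lt_iff₀ (by positivity)] at this
      linarith
  rw [harmonicFn, if_neg (not_le.mpr hkx), hfl]

/-- Weighting functions (dual feasible functions) `[0, 1] → [0, 1]`. -/
def IsWeightingFunction (g : ℝ → ℝ) : Prop :=
  (∀ x ∈ Set.Icc (0 : ℝ) 1, g x ∈ Set.Icc (0 : ℝ) 1) ∧
    ∀ (m : ℕ) (x : Fin m → ℝ), 0 < m → (∀ i, x i ∈ Set.Icc (0 : ℝ) 1) →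
      ∑ i, x i ≤ 1 → ∑ i, g (x i) ≤ 1

/-- `T_k`: the smallest positive constant `c` such that `f_k / c` is a weighting function. -/
noncomputable def harmonicConst (k : ℕ) : ℝ :=
  sInf {c : ℝ | 0 < c ∧ IsWeightingFunction fun x => harmonicFn k x / c}

theorem harmonicFn_bounds {k : ℕ} (hk : 3 ≤ k) {x : ℝ} (hx : x ∈ Set.Icc (0:ℝ) 1) :
   0 ≤ harmonicFn k x ∧ harmonicFn k x ≤ 3 * x ∧ harmonicFn k x ≤ 1 := by
  have hk' : (3:ℝ) ≤ k := by exact_mod_cast hk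
  unfold harmonicFn
  split_ifs with h
  · have h1 : (k:ℝ)/((k:ℝ)-2) ≤ 3 := by rw [div_le_iff₀] <;> linarith
    have h0 : 0 ≤ (k:ℝ)/((k:ℝ)-2) := div_nonneg (by linarith) (by linarith)
    refine ⟨mul_nonneg h0 hx.1, mul_le_mul_of_nonneg_right h1 hx.1, ?_⟩
    calc _ ≤ (k:ℝ)/((k:ℝ)-2) * (1/k) := mul_le_mul_of_nonneg_left h h0
      _ = 1/((k:ℝ)-2) := by have : (k:ℝ)-2 ≠ 0 := by linarith
                            field_simp
      _ ≤ 1 := by rw [div_le_iff₀] <;> linarith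
  · have hx0 : 0 < x := lt_trans (by positivity) (not_le.mp h)
    have h1 : 1 ≤ ⌊1/x⌋₊ := Nat.le_floor (by rw [Nat.cast_one, le_div_iff₀ hx0]; linarith [hx.2])
    have h1' : (1:ℝ) ≤ ⌊1/x⌋₊ := by exact_mod_cast h1
    have h2 := Nat.lt_floor_add_one (1/x)
    rw [div_lt_iff₀ hx0] at h2
    refine ⟨by positivity, ?_, ?_⟩
    · rw [div_le_iff₀ (by linarith)]; nlinarith
    · rw [div_le_iff₀ (by linarith)]; linarith

theorem harmonicConst_isLeast {k : ℕ} (hk : 3 ≤ k) :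
  IsLeast {c : ℝ | 0 < c ∧ IsWeightingFunction fun x => harmonicFn k x / c} (harmonicConst k) := by
  have key : ∀ c : ℝ, (0 < c ∧ IsWeightingFunction fun x => harmonicFn k x / c) ↔
     1 ≤ c ∧ ∀ (m : ℕ) (x : Fin m → ℝ), 0 < m → (∀ i, x i ∈ Set.Icc (0 : ℝ) 1) →
      ∑ i, x i ≤ 1 → ∑ i, harmonicFn k (x i) ≤ c := by
    intro c
    constructor
    · rintro ⟨h0, h1, h2⟩
      constructor
      · have := (h1 1 (by simp)).2
        have e : harmonicFn k 1 = 1 := by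
          simpa using harmonicFn_of_mem_Ioc (k := k) (q := 1) (x := 1) le_rfl (by omega) (by norm_num)
        simp only [e] at this
        rwa [div_le_iff₀ h0, one_mul] at this
      · intro m x hm hx hs
        have := h2 m x hm hx hs
        rw [← Finset.sum_div, div_le_iff₀ h0, one_mul] at this
        exact this
    · rintro ⟨h0, h1⟩
      refine ⟨by linarith, fun x hx => ⟨div_nonneg (harmonicFn_bounds hk hx).1 (by linarith), ?_⟩, ?_⟩
      · show _ / _ ≤ _
        rw [div_le_iff₀ (by linarith)]; linarith [(harmonicFn_bounds hk hx).2.2]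
      · intro m x hm hx hs
        rw [← Finset.sum_div, div_le_iff₀ (by linarith), one_mul]
        exact h1 m x hm hx hs
  have hne : {c : ℝ | 0 < c ∧ IsWeightingFunction fun x => harmonicFn k x / c}.Nonempty := by
    refine ⟨3, (key 3).2 ⟨by norm_num, fun m x hm hx hs => ?_⟩⟩
    calc _ ≤ ∑ i, 3 * x i := Finset.sum_le_sum fun i _ => (harmonicFn_bounds hk (hx i)).2.1
      _ ≤ 3 := by rw [← Finset.mul_sum]; linarith
  refine ⟨(key _).2 ⟨?_, ?_⟩, fun c hc => csInf_le ⟨0, fun c hc => hc.1.le⟩ hc⟩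
  · exact le_csInf hne fun c hc => ((key c).1 hc).1
  · intro m x hm hx hs
    exact le_csInf hne fun c hc => ((key c).1 hc).2 m x hm hx hs

/-! ### Bin packing of `d`-dimensional boxes -/

/-- The open box with lowest corner `p` and side lengths `s`. -/
def openBox {d : ℕ} (p s : Fin d → ℝ) : Set (Fin d → ℝ) :=
  Set.univ.pi fun j => Set.Ioo (p j) (p j + s j)

/-- A packing, without rotations, of the items with side lengths `len i` into `N` unit cubes. -/
structure BoxPacking {ι : Type*} {d : ℕ} (len : ι → Fin d → ℝ) (N : ℕ) where
  bin : ι → Fin N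
  pos : ι → Fin d → ℝ
  inside : ∀ i j, 0 ≤ pos i j ∧ pos i j + len i j ≤ 1
  disjoint : ∀ i i', i ≠ i' → bin i = bin i' →
    Disjoint (openBox (pos i) (len i)) (openBox (pos i') (len i'))

/-- The minimum number of unit cubes needed to pack the items. -/
noncomputable def optBP {ι : Type*} {d : ℕ} (len : ι → Fin d → ℝ) : ℕ :=
  sInf {N : ℕ | Nonempty (BoxPacking len N)}

theorem boxPacking_exists {ι : Type*} [Fintype ι] {d : ℕ} (len : ι → Fin d → ℝ) (h : ∀ i j, len i j ∈ Set.Ioc (0:ℝ) 1) :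
   {N : ℕ | Nonempty (BoxPacking len N)}.Nonempty :=
 ⟨Fintype.card ι, ⟨⟨Fintype.equivFin ι, fun _ _ => 0, fun i j => by simpa using (h i j).2,
   fun i i' hne he => absurd ((Fintype.equivFin ι).injective he) hne⟩⟩⟩

/-! ### Shelf-based fractional packings of rectangles -/

structure Rect where
  width : ℝ
  height : ℝ

/-- Rounding a box with `b + 1` dimensions (`b` base dimensions, the last one is the height) to a
rectangle. -/
noncomputable def roundBox (k : ℕ) {b : ℕ} (l : Fin (b + 1) → ℝ) : Rect where
  width := ∏ j : Fin b, harmonicFn k (l j.castSucc)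
  height := l (Fin.last b)

/-- `Slicing horiz r L`: the list `L` of rectangles arises from `r` by recursive slicing, with
vertical cuts, and also with horizontal cuts if `horiz` holds. -/
inductive Slicing (horiz : Prop) : Rect → List Rect → Prop
  | uncut (r : Rect) : Slicing horiz r [r]
  | vert {w₁ w₂ h : ℝ} {L₁ L₂ : List Rect} : 0 < w₁ → 0 < w₂ →
      Slicing horiz ⟨w₁, h⟩ L₁ → Slicing horiz ⟨w₂, h⟩ L₂ →
      Slicing horiz ⟨w₁ + w₂, h⟩ (L₁ ++ L₂)
  | horz {w h₁ h₂ : ℝ} {L₁ L₂ : List Rect} : horiz → 0 < h₁ → 0 < h₂ →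
      Slicing horiz ⟨w, h₁⟩ L₁ → Slicing horiz ⟨w, h₂⟩ L₂ →
      Slicing horiz ⟨w, h₁ + h₂⟩ (L₁ ++ L₂)

/-- The index type of all slices of all items. -/
abbrev SliceIdx {ι : Type*} (slices : ι → List Rect) : Type _ :=
  Σ i : ι, Fin (slices i).length

/-- The rectangle of a slice. -/
def sliceRect {ι : Type*} (slices : ι → List Rect) (s : SliceIdx slices) : Rect :=
  (slices s.1).get s.2

/-- The open rectangle with lower left corner `(x, y)` and the dimensions of `r`. -/
def openRect (x y : ℝ) (r : Rect) : Set (ℝ × ℝ) :=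
  Set.Ioo x (x + r.width) ×ˢ Set.Ioo y (y + r.height)

/-- A shelf-based `δ`-fractional packing of the rectangles `K i` into `N` unit squares. Items of
height `> δ` are `δ`-large, the others are `δ`-small. A shelf has width `1`, so that its left edge
is the left edge of its bin. -/
structure ShelfPacking {ι : Type*} (δ : ℝ) (K : ι → Rect) (N : ℕ) where
  slices : ι → List Rect
  slicing : ∀ i, Slicing ((K i).height ≤ δ) (K i) (slices i)
  numShelves : ℕ
  shelfHeight : Fin numShelves → ℝ
  shelfBin : Fin numShelves → Fin N
  shelfBot : Fin numShelves → ℝ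
  shelf_pos : ∀ t, 0 < shelfHeight t
  shelf_inside : ∀ t, 0 ≤ shelfBot t ∧ shelfBot t + shelfHeight t ≤ 1
  shelf_disjoint : ∀ t t', t ≠ t' → shelfBin t = shelfBin t' →
    Disjoint (openRect 0 (shelfBot t) ⟨1, shelfHeight t⟩)
      (openRect 0 (shelfBot t') ⟨1, shelfHeight t'⟩)
  bin : SliceIdx slices → Fin N
  left : SliceIdx slices → ℝ
  bot : SliceIdx slices → ℝ
  inside : ∀ s, 0 ≤ left s ∧ left s + (sliceRect slices s).width ≤ 1 ∧
    0 ≤ bot s ∧ bot s + (sliceRect slices s).height ≤ 1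
  disjoint : ∀ s s', s ≠ s' → bin s = bin s' →
    Disjoint (openRect (left s) (bot s) (sliceRect slices s))
      (openRect (left s') (bot s') (sliceRect slices s'))
  /-- Slices of large items lie in shelves, on the bottom edge of the shelf. -/
  large : ∀ s, δ < (K s.1).height →
    ∃ t, shelfBin t = bin s ∧ shelfBot t = bot s ∧ (sliceRect slices s).height ≤ shelfHeight t
  /-- Slices of small items lie outside the shelves. -/
  small : ∀ s, (K s.1).height ≤ δ → ∀ t, shelfBin t = bin s →
    Disjoint (openRect (left s) (bot s) (sliceRect slices s))
      (openRect 0 (shelfBot t) ⟨1, shelfHeight t⟩)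

/-- The shelves have at most `⌈1 / δ ^ 2⌉` distinct heights, each of them being the height of some
`δ`-large item. -/
def ShelfPacking.IsStructured {ι : Type*} {δ : ℝ} {K : ι → Rect} {N : ℕ}
    (P : ShelfPacking δ K N) : Prop :=
  (Set.range P.shelfHeight).ncard ≤ ⌈1 / δ ^ 2⌉₊ ∧
    ∀ t, ∃ i, δ < (K i).height ∧ P.shelfHeight t = (K i).height

/-- The minimum number of bins in a structured `δ`-fractional packing. -/
noncomputable def sopt {ι : Type*} (δ : ℝ) (K : ι → Rect) : ℕ :=
  sInf {N : ℕ | ∃ P : ShelfPacking δ K N, P.IsStructured}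

/-!
Cut all bins of an optimal box packing by a hyperplane orthogonal to the last axis. Intervals on a
line with total weight at most `W` at every point have a fractional colouring of total weight `W`
by families of disjoint intervals. By induction on the dimension, a weighting function `g` then
satisfies `∑ ∏ g(ℓ_j) ≤ 1` for disjoint boxes in a unit cube, so that the rounded items met by the
hyperplane have total width at most `W = T ^ b * opt`.

Lay the large items out side by side from high to low and cut the row into `⌈1 / δ ^ 2⌉` groups of
equal width `g`, where `g ≤ δ W`. If the items of each group take the height of the highest item of
the next lower group, they only shrink, so the heights at which they lie in the box packing still
give a fractional colouring, each of whose colour classes is a configuration of shelves that fits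
into a unit square. By Carathéodory's theorem `⌈1 / δ ^ 2⌉` configurations suffice, and rounding
their weights up gives integer numbers of bins. A group fits into the shelves reserved for the next
higher one, and the highest group gets `⌈g⌉` bins of its own.

The total weight of the configurations exceeds the total area of the items, so the area outside the
shelves exceeds the area of the small items. These are cut into thin horizontal strips, which fill
the free space row by row.
-/

open Set Filter Topology

/-! ### Fractional colourings of intervals -/

/-- A fractional colouring `x`, with colour classes in `V`, is extended to one more interval `e` of
weight `μ`. Here `φ v` counts the intervals of the class `v` that keep `e` out of it. -/
theorem add_smul_mem_of_mem_convexHull {E : Type*} [AddCommGroup E] [Module ℝ E] {V T : Set E}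
    (hT : Convex ℝ T) (hVT : V ⊆ T) (φ : E →ₗ[ℝ] ℝ) {e : E}
    (hV : ∀ v ∈ V, 0 ≤ φ v ∧ v + e ∈ T ∨ 1 ≤ φ v) {x : E} (hx : x ∈ convexHull ℝ V) {μ : ℝ}
    (hμ : 0 ≤ μ) (hφ : φ x + μ ≤ 1) : x + μ • e ∈ T := by
  have hconv : Convex ℝ {x | x ∈ T ∧ ∃ t : ℝ, 0 ≤ t ∧ 1 - φ x ≤ t ∧ x + t • e ∈ T} := by
    rintro x ⟨hx, t, ht, hxt, hxe⟩ y ⟨hy, u, hu, hyu, hye⟩ p q hp hq hpq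
    refine ⟨hT hx hy hp hq hpq, p * t + q * u, by positivity, ?_, ?_⟩
    · simp only [map_add, map_smul, smul_eq_mul]
      nlinarith
    · convert hT hxe hye hp hq hpq using 1
      module
  have hsub : V ⊆ {x | x ∈ T ∧ ∃ t : ℝ, 0 ≤ t ∧ 1 - φ x ≤ t ∧ x + t • e ∈ T} := by
    intro v hv
    rcases hV v hv with ⟨h0, he⟩ | h1
    · exact ⟨hVT hv, 1, zero_le_one, by linarith, by rwa [one_smul]⟩
    · exact ⟨hVT hv, 0, le_rfl, by linarith, by simpa using hVT hv⟩
  obtain ⟨hxT, t, ht, hxt, hxe⟩ := convexHull_min hsub hconv hx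
  rcases ht.eq_or_lt with rfl | ht
  · obtain rfl : μ = 0 := by linarith
    simpa using hxT
  · have := hT.add_smul_mem hxT hxe (t := μ / t) ⟨by positivity, (div_le_one ht).2 (by linarith)⟩
    rwa [smul_smul, div_mul_cancel₀ _ ht.ne'] at this

section Intervals

variable {ι : Type*} {a e w : ι → ℝ} {S : Finset ι}

theorem exists_mem_Ioo_forall_notMem_disjoint {i : ι} (hi : a i < e i)
    (hmax : ∀ j ∈ S, a j ≤ a i) :
    ∃ z ∈ Ioo (a i) (e i), ∀ j ∈ S, z ∉ Ioo (a j) (e j) →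
      Disjoint (Ioo (a j) (e j)) (Ioo (a i) (e i)) := by
  have hnear : ∀ᶠ z in nhdsWithin (a i) (Ioi (a i)), ∀ j ∈ S, a i < e j → z < e j := by
    rw [Filter.eventually_all_finset]
    intro j _
    by_cases hj : a i < e j
    · filter_upwards [Ioo_mem_nhdsGT hj] with z hz _ using hz.2
    · exact .of_forall fun z hz => absurd hz hj
  obtain ⟨z, hz, hzi⟩ := (hnear.and (Ioo_mem_nhdsGT hi)).exists
  refine ⟨z, hzi, fun j hj hzj => ?_⟩
  have hej : e j ≤ a i := by
    by_contra! hlt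
    exact hzj ⟨(hmax j hj).trans_lt hzi.1, hz j hj hlt⟩
  exact disjoint_left.2 fun x hx hx' => by linarith [hx.2, hx'.1]

/-- The indicator vectors of the subfamilies of `S` whose intervals `(a i, e i)` are pairwise
disjoint. A point of their convex hull is a fractional colouring of the intervals of `S` with
colours of total weight `1`. -/
def disjointIndicators (a e : ι → ℝ) (S : Finset ι) : Set (ι → ℝ) :=
  (fun c : Finset ι => (c : Set ι).indicator 1) ''
    {c | c ⊆ S ∧ (c : Set ι).PairwiseDisjoint fun i => Ioo (a i) (e i)}

theorem nonneg_of_mem_disjointIndicators {v : ι → ℝ} (hv : v ∈ disjointIndicators a e S) :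
    0 ≤ v := by
  obtain ⟨c, -, rfl⟩ := hv
  exact indicator_nonneg fun _ _ => zero_le_one

theorem disjointIndicators_mono {S' : Finset ι} (h : S ⊆ S') :
    disjointIndicators a e S ⊆ disjointIndicators a e S' :=
  image_mono fun _ hc => ⟨hc.1.trans h, hc.2⟩

theorem add_single_mem_or_one_le_sum_of_mem_disjointIndicators [DecidableEq ι] {i : ι}
    (hi : i ∉ S) {z : ℝ}
    (hz : ∀ j ∈ S, z ∉ Ioo (a j) (e j) → Disjoint (Ioo (a j) (e j)) (Ioo (a i) (e i)))
    {v : ι → ℝ} (hv : v ∈ disjointIndicators a e S) :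
    v + Pi.single i 1 ∈ disjointIndicators a e (insert i S) ∨
      1 ≤ ∑ j ∈ S with z ∈ Ioo (a j) (e j), v j := by
  have hv0 := nonneg_of_mem_disjointIndicators hv
  obtain ⟨c, ⟨hcS, hc⟩, rfl⟩ := hv
  by_cases hfree : ∀ j ∈ c, z ∉ Ioo (a j) (e j)
  · refine .inl ⟨insert i c, ⟨Finset.insert_subset_insert i hcS, ?_⟩, ?_⟩
    · rw [Finset.coe_insert]
      exact hc.insert fun j hj _ => (hz j (hcS hj) (hfree j hj)).symm
    · have hic : i ∉ c := fun h => hi (hcS h)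
      ext j
      by_cases hj : j = i
      · subst hj; simp [hic]
      · simp [hj, indicator]
  · push Not at hfree
    obtain ⟨j, hjc, hjz⟩ := hfree
    refine .inr ?_
    calc (1 : ℝ) = (c : Set ι).indicator 1 j := by simp [hjc]
      _ ≤ _ := Finset.single_le_sum (fun l _ => hv0 l) (Finset.mem_filter.2 ⟨hcS hjc, hjz⟩)

theorem indicator_mem_convexHull_disjointIndicators (hae : ∀ i ∈ S, a i < e i)
    (hw : ∀ i ∈ S, 0 ≤ w i) (hcov : ∀ y, ∑ i ∈ S with y ∈ Ioo (a i) (e i), w i ≤ 1) :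
    (S : Set ι).indicator w ∈ convexHull ℝ (disjointIndicators a e S) := by
  classical
  induction S using Finset.induction_on_max_value a with
  | empty => exact subset_convexHull ℝ _ ⟨∅, by simp, by simp⟩
  | insert i S hi hmax ih =>
    have hcovS y : ∑ j ∈ S with y ∈ Ioo (a j) (e j), w j ≤ 1 :=
      (Finset.sum_le_sum_of_subset_of_nonneg
        (Finset.filter_subset_filter _ (Finset.subset_insert i S))
        fun j hj _ => hw j (Finset.mem_filter.1 hj).1).trans (hcov y)
    simp only [Finset.forall_mem_insert] at hae hw
    obtain ⟨z, hz, hdisj⟩ := exists_mem_Ioo_forall_notMem_disjoint hae.1 hmax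
    let φ : (ι → ℝ) →ₗ[ℝ] ℝ := ∑ j ∈ S with z ∈ Ioo (a j) (e j), LinearMap.proj j
    have hφ (v : ι → ℝ) : φ v = ∑ j ∈ S with z ∈ Ioo (a j) (e j), v j := by simp [φ]
    have hinsert : ((insert i S : Finset ι) : Set ι).indicator w =
        (S : Set ι).indicator w + w i • Pi.single i (1 : ℝ) := by
      ext j
      by_cases hj : j = i
      · subst hj; simp [hi]
      · simp [hj, indicator]
    rw [hinsert]
    refine add_smul_mem_of_mem_convexHull (convex_convexHull ℝ _) ?_ φ (fun v hv => ?_)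
      (ih hae.2 hw.2 hcovS) hw.1 ?_
    · exact (disjointIndicators_mono (Finset.subset_insert i S)).trans (subset_convexHull ℝ _)
    · rw [hφ]
      exact (add_single_mem_or_one_le_sum_of_mem_disjointIndicators hi hdisj hv).imp_left
        fun h => ⟨Finset.sum_nonneg fun j _ => nonneg_of_mem_disjointIndicators hv j,
          subset_convexHull ℝ _ h⟩
    · have := hcov z
      rw [Finset.filter_insert, if_pos hz, Finset.sum_insert (by simp [hi])] at this
      rw [hφ, Finset.sum_congr rfl fun j hj => indicator_of_mem
        (Finset.mem_coe.2 (Finset.mem_filter.1 hj).1) w]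
      linarith

theorem indicator_div_mem_convexHull_disjointIndicators (hae : ∀ i ∈ S, a i < e i)
    (hw : ∀ i ∈ S, 0 ≤ w i) {W : ℝ} (hW : 0 < W)
    (hcov : ∀ y, ∑ i ∈ S with y ∈ Ioo (a i) (e i), w i ≤ W) :
    (S : Set ι).indicator (fun i => w i / W) ∈ convexHull ℝ (disjointIndicators a e S) := by
  refine indicator_mem_convexHull_disjointIndicators hae
    (fun i hi => div_nonneg (hw i hi) hW.le) fun y => ?_
  rw [← Finset.sum_div]
  exact (div_le_one hW).2 (hcov y)

theorem sum_indicator_one_mul {c : Finset ι} (hc : c ⊆ S) (F : ι → ℝ) :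
    ∑ i ∈ S, (c : Set ι).indicator 1 i * F i = ∑ i ∈ c, F i := by
  classical
  simp [indicator, Finset.inter_eq_right.2 hc]

theorem sum_mul_le_of_cover (hae : ∀ i ∈ S, a i < e i) (hw : ∀ i ∈ S, 0 ≤ w i) {W : ℝ}
    (hW : 0 ≤ W) (hcov : ∀ y, ∑ i ∈ S with y ∈ Ioo (a i) (e i), w i ≤ W) {F : ι → ℝ}
    (hF : ∀ c ⊆ S, (c : Set ι).PairwiseDisjoint (fun i => Ioo (a i) (e i)) → ∑ i ∈ c, F i ≤ 1) :
    ∑ i ∈ S, w i * F i ≤ W := by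
  refine le_of_forall_gt_imp_ge_of_dense fun V hV => ?_
  have hV0 : 0 < V := hW.trans_lt hV
  have hconv : Convex ℝ {v : ι → ℝ | ∑ i ∈ S, v i * F i ≤ 1} := by
    refine convex_halfSpace_le (f := fun v : ι → ℝ => ∑ i ∈ S, v i * F i) ⟨?_, ?_⟩ 1
    · intro u v
      simp only [Pi.add_apply, add_mul, Finset.sum_add_distrib]
    · intro t v
      simp only [Pi.smul_apply, smul_eq_mul, Finset.mul_sum, mul_assoc]
  have hsub : disjointIndicators a e S ⊆ {v : ι → ℝ | ∑ i ∈ S, v i * F i ≤ 1} := by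
    rintro _ ⟨c, ⟨hcS, hc⟩, rfl⟩
    exact (sum_indicator_one_mul hcS F).trans_le (hF c hcS hc)
  have hmem : ∑ i ∈ S, (S : Set ι).indicator (fun i => w i / V) i * F i ≤ 1 :=
    convexHull_min hsub hconv (indicator_div_mem_convexHull_disjointIndicators hae hw hV0
      fun y => (hcov y).trans hV.le)
  rw [Finset.sum_congr rfl fun i hi => by rw [indicator_of_mem (Finset.mem_coe.2 hi),
    div_mul_eq_mul_div], ← Finset.sum_div] at hmem
  exact (div_le_one hV0).1 hmem

theorem sum_length_le_one (hae : ∀ i ∈ S, a i < e i) (hin : ∀ i ∈ S, 0 ≤ a i ∧ e i ≤ 1)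
    (hdis : (S : Set ι).PairwiseDisjoint fun i => Ioo (a i) (e i)) :
    ∑ i ∈ S, (e i - a i) ≤ 1 := by
  have hsub : ⋃ i ∈ S, Ioo (a i) (e i) ⊆ Icc (0 : ℝ) 1 :=
    iUnion₂_subset fun i hi =>
      Ioo_subset_Icc_self.trans (Icc_subset_Icc (hin i hi).1 (hin i hi).2)
  calc ∑ i ∈ S, (e i - a i) = ∑ i ∈ S, MeasureTheory.volume.real (Ioo (a i) (e i)) :=
        Finset.sum_congr rfl fun i hi => (Real.volume_real_Ioo_of_le (hae i hi).le).symm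
    _ = MeasureTheory.volume.real (⋃ i ∈ S, Ioo (a i) (e i)) :=
        (MeasureTheory.measureReal_biUnion_finset hdis (fun _ _ => measurableSet_Ioo)
          fun _ _ => measure_Ioo_lt_top.ne).symm
    _ ≤ MeasureTheory.volume.real (Icc (0 : ℝ) 1) := MeasureTheory.measureReal_mono hsub (by simp)
    _ = 1 := by simp

end Intervals

universe u in
theorem exists_pos_sum_smul_of_mem_convexHull {E : Type u} [AddCommGroup E] [Module ℝ E]
    [FiniteDimensional ℝ E] {V : Set E} {x : E} (hx : x ∈ convexHull ℝ V) :
    ∃ (κ : Type u) (_ : Fintype κ) (v : κ → E) (y : κ → ℝ),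
      Fintype.card κ ≤ Module.finrank ℝ E + 1 ∧ (∀ k, v k ∈ V) ∧ (∀ k, 0 < y k) ∧
        ∑ k, y k = 1 ∧ ∑ k, y k • v k = x := by
  obtain ⟨κ, _, v, y, hvV, hv, hy, hysum, hyx⟩ := eq_pos_convex_span_of_mem_convexHull hx
  refine ⟨κ, inferInstance, v, y, ?_, fun k => hvV (mem_range_self k), hy, hysum, hyx⟩
  exact hv.card_le_finrank_succ.trans (Nat.succ_le_succ (Submodule.finrank_le _))

theorem exists_interval_configurations {ι : Type*} {a e w : ι → ℝ} {S : Finset ι}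
    (hae : ∀ i ∈ S, a i < e i) (hin : ∀ i ∈ S, 0 ≤ a i ∧ e i ≤ 1) (hw : ∀ i ∈ S, 0 ≤ w i)
    {W : ℝ} (hW : 0 < W) (hcov : ∀ y, ∑ i ∈ S with y ∈ Ioo (a i) (e i), w i ≤ W)
    {r : ℕ} {ty : ι → Fin r} {h : Fin r → ℝ} (hh : ∀ i ∈ S, h (ty i) ≤ e i - a i) :
    ∃ (κ : Type) (_ : Fintype κ) (n : κ → Fin r → ℕ) (y : κ → ℝ),
      Fintype.card κ ≤ r + 1 ∧ (∀ k, ∑ j, n k j * h j ≤ 1) ∧ (∀ k, 0 < y k) ∧ ∑ k, y k = W ∧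
        ∀ j, ∑ k, y k * n k j = ∑ i ∈ S with ty i = j, w i := by
  let V : Set (Fin r → ℝ) := {v | ∃ n : Fin r → ℕ, ∑ j, n j * h j ≤ 1 ∧ v = fun j => (n j : ℝ)}
  let Φ : (ι → ℝ) →ₗ[ℝ] (Fin r → ℝ) :=
    LinearMap.pi fun j => ∑ i ∈ S with ty i = j, LinearMap.proj i
  have hΦ (v : ι → ℝ) (j : Fin r) : Φ v j = ∑ i ∈ S with ty i = j, v i := by simp [Φ]
  have hV : Φ '' disjointIndicators a e S ⊆ V := by
    rintro _ ⟨_, ⟨c, ⟨hcS, hc⟩, rfl⟩, rfl⟩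
    refine ⟨fun j => (c.filter (ty · = j)).card, ?_, ?_⟩
    · calc ∑ j, ((c.filter (ty · = j)).card : ℝ) * h j = ∑ i ∈ c, h (ty i) := by
            rw [← Finset.sum_fiberwise' c ty h]
            simp only [Finset.sum_const, nsmul_eq_mul]
        _ ≤ ∑ i ∈ c, (e i - a i) := Finset.sum_le_sum fun i hi => hh i (hcS hi)
        _ ≤ 1 := sum_length_le_one (fun i hi => hae i (hcS hi)) (fun i hi => hin i (hcS hi)) hc
    · ext j
      rw [hΦ, Finset.sum_filter]
      calc ∑ i ∈ S, (if ty i = j then (c : Set ι).indicator (1 : ι → ℝ) i else 0)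
          = ∑ i ∈ S, (c : Set ι).indicator 1 i * if ty i = j then 1 else 0 :=
            Finset.sum_congr rfl fun i _ => (mul_boole _ _).symm
        _ = ∑ i ∈ c, if ty i = j then 1 else 0 := sum_indicator_one_mul hcS _
        _ = (c.filter (ty · = j)).card := by rw [Finset.sum_boole]
  have hmem : Φ ((S : Set ι).indicator fun i => w i / W) ∈ convexHull ℝ V := by
    refine convexHull_mono hV ?_
    rw [← LinearMap.image_convexHull]
    exact mem_image_of_mem _ (indicator_div_mem_convexHull_disjointIndicators hae hw hW hcov)
  obtain ⟨κ, _, v, y, hcard, hvV, hy, hysum, hyx⟩ := exists_pos_sum_smul_of_mem_convexHull hmem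
  choose n hn hvn using hvV
  refine ⟨κ, inferInstance, n, fun k => W * y k, by simpa using hcard, hn,
    fun k => mul_pos hW (hy k), by rw [← Finset.mul_sum, hysum, mul_one], fun j => ?_⟩
  have hj := congr_fun hyx j
  simp only [Finset.sum_apply, Pi.smul_apply, smul_eq_mul, hvn, hΦ] at hj
  simp_rw [mul_assoc]
  rw [← Finset.mul_sum, hj, Finset.mul_sum]
  refine Finset.sum_congr rfl fun i hi => ?_
  rw [indicator_of_mem (Finset.mem_coe.2 (Finset.mem_filter.1 hi).1), mul_div_cancel₀ _ hW.ne']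

/-! ### Sections of box packings -/

theorem disjoint_openBox_castSucc {d : ℕ} {p s p' s' : Fin (d + 1) → ℝ}
    (h : Disjoint (openBox p s) (openBox p' s')) {y : ℝ}
    (hy : y ∈ Ioo (p (Fin.last d)) (p (Fin.last d) + s (Fin.last d)))
    (hy' : y ∈ Ioo (p' (Fin.last d)) (p' (Fin.last d) + s' (Fin.last d))) :
    Disjoint (openBox (fun j : Fin d => p j.castSucc) fun j => s j.castSucc)
      (openBox (fun j : Fin d => p' j.castSucc) fun j => s' j.castSucc) := by
  have hsnoc {p s : Fin (d + 1) → ℝ} {z : Fin d → ℝ}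
      (hy : y ∈ Ioo (p (Fin.last d)) (p (Fin.last d) + s (Fin.last d)))
      (hz : z ∈ openBox (fun j : Fin d => p j.castSucc) fun j => s j.castSucc) :
      (Fin.snoc z y : Fin (d + 1) → ℝ) ∈ openBox p s := by
    intro j _
    refine Fin.lastCases ?_ (fun j => ?_) j
    · simpa using hy
    · simpa using hz j trivial
  exact disjoint_left.2 fun z hz hz' => disjoint_left.1 h (hsnoc hy hz) (hsnoc hy' hz')

namespace IsWeightingFunction

variable {g : ℝ → ℝ} {ι : Type*} {S : Finset ι}

theorem sum_le_one (hg : IsWeightingFunction g) {x : ι → ℝ} (hx : ∀ i ∈ S, x i ∈ Icc (0 : ℝ) 1)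
    (hs : ∑ i ∈ S, x i ≤ 1) : ∑ i ∈ S, g (x i) ≤ 1 := by
  rcases S.eq_empty_or_nonempty with rfl | hne
  · simp
  have hsum (F : ι → ℝ) : ∑ n, F (S.equivFin.symm n) = ∑ i ∈ S, F i := by
    rw [Equiv.sum_comp S.equivFin.symm fun i : S => F i, Finset.sum_coe_sort]
  rw [← hsum fun i => g (x i)]
  exact hg.2 S.card _ hne.card_pos (fun n => hx _ (S.equivFin.symm n).2) ((hsum x).trans_le hs)

theorem sum_prod_le_one (hg : IsWeightingFunction g) {d : ℕ} {pos len : ι → Fin d → ℝ}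
    (hlen : ∀ i ∈ S, ∀ j, len i j ∈ Ioc (0 : ℝ) 1)
    (hin : ∀ i ∈ S, ∀ j, 0 ≤ pos i j ∧ pos i j + len i j ≤ 1)
    (hdis : (S : Set ι).PairwiseDisjoint fun i => openBox (pos i) (len i)) :
    ∑ i ∈ S, ∏ j, g (len i j) ≤ 1 := by
  induction d generalizing S with
  | zero =>
    have hcard : S.card ≤ 1 := Finset.card_le_one.2 fun i hi i' hi' => by
      by_contra hne
      have hmem (q) : (0 : Fin 0 → ℝ) ∈ openBox (pos q) (len q) := fun j => j.elim0
      exact disjoint_left.1 (hdis hi hi' hne) (hmem i) (hmem i')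
    simpa using hcard
  | succ d ih =>
    simp only [Fin.prod_univ_castSucc]
    have hmem i (hi : i ∈ S) j : len i j ∈ Icc (0 : ℝ) 1 := Ioc_subset_Icc_self (hlen i hi j)
    refine sum_mul_le_of_cover (a := fun i => pos i (Fin.last d))
      (e := fun i => pos i (Fin.last d) + len i (Fin.last d))
      (fun i hi => lt_add_of_pos_right _ (hlen i hi _).1)
      (fun i hi => Finset.prod_nonneg fun j _ => (hg.1 _ (hmem i hi _)).1) zero_le_one
      (fun y => ?_) (fun c hc hcdis => ?_)
    · refine ih (pos := fun i j => pos i j.castSucc) (len := fun i j => len i j.castSucc)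
        (fun i hi j => hlen i (Finset.mem_filter.1 hi).1 _)
        (fun i hi j => hin i (Finset.mem_filter.1 hi).1 _) fun i hi i' hi' hne => ?_
      obtain ⟨hi, hy⟩ := Finset.mem_filter.1 hi
      obtain ⟨hi', hy'⟩ := Finset.mem_filter.1 hi'
      exact disjoint_openBox_castSucc (hdis hi hi' hne) hy hy'
    · refine hg.sum_le_one (fun i hi => hmem i (hc hi) _) ?_
      simpa only [add_sub_cancel_left] using sum_length_le_one
        (fun i hi => lt_add_of_pos_right _ (hlen i (hc hi) _).1) (fun i hi => hin i (hc hi) _) hcdis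

end IsWeightingFunction

theorem BoxPacking.sum_prod_le {ι : Type*} [Fintype ι] {b m : ℕ} {len : ι → Fin (b + 1) → ℝ}
    (P : BoxPacking len m) (hlen : ∀ i j, len i j ∈ Ioc (0 : ℝ) 1) {g : ℝ → ℝ} {T : ℝ}
    (hT : 0 < T) (hg : IsWeightingFunction fun x => g x / T) (y : ℝ) :
    ∑ i with y ∈ Ioo (P.pos i (Fin.last b)) (P.pos i (Fin.last b) + len i (Fin.last b)),
      ∏ j : Fin b, g (len i j.castSucc) ≤ T ^ b * m := by
  set S := Finset.univ.filter fun i =>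
    y ∈ Ioo (P.pos i (Fin.last b)) (P.pos i (Fin.last b) + len i (Fin.last b)) with hS
  have hbin (t : Fin m) : ∑ i ∈ S with P.bin i = t, ∏ j : Fin b, g (len i j.castSucc) ≤ T ^ b := by
    have hle := hg.sum_prod_le_one (S := S.filter fun i => P.bin i = t)
      (pos := fun i j => P.pos i j.castSucc) (len := fun i (j : Fin b) => len i j.castSucc)
      (fun i _ j => hlen i _) (fun i _ j => P.inside i _) fun i hi i' hi' hne => ?_
    · simp only [Finset.prod_div_distrib, Finset.prod_const, Finset.card_univ, Fintype.card_fin,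
        ← Finset.sum_div] at hle
      rwa [div_le_one (by positivity)] at hle
    · simp only [hS, Finset.coe_filter, Finset.mem_filter, Finset.mem_univ, true_and,
        mem_ofPred_eq] at hi hi'
      exact disjoint_openBox_castSucc (P.disjoint i i' hne (hi.2.trans hi'.2.symm)) hi.1 hi'.1
  calc ∑ i ∈ S, ∏ j : Fin b, g (len i j.castSucc)
      = ∑ t, ∑ i ∈ S with P.bin i = t, ∏ j : Fin b, g (len i j.castSucc) :=
        (Finset.sum_fiberwise S P.bin _).symm
    _ ≤ ∑ _t : Fin m, T ^ b := Finset.sum_le_sum fun t _ => hbin t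
    _ = T ^ b * m := by simp [mul_comm]

theorem harmonicFn_pos {k : ℕ} (hk : 3 ≤ k) {x : ℝ} (hx : x ∈ Ioc (0 : ℝ) 1) :
    0 < harmonicFn k x := by
  have hk' : (3 : ℝ) ≤ k := by exact_mod_cast hk
  unfold harmonicFn
  split_ifs with h
  · exact mul_pos (div_pos (by linarith) (by linarith)) hx.1
  · have : 0 < ⌊1 / x⌋₊ := Nat.floor_pos.2 ((one_le_div hx.1).2 hx.2)
    positivity

/-! ### Slicing along a line of cells -/

/-- The segments `[s i, s i + w i)` with `i ∈ S` are laid out consecutively on a line, starting at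
`0`. -/
structure IsTiling {ι : Type*} (S : Finset ι) (s w : ι → ℝ) : Prop where
  pairwiseDisjoint : (S : Set ι).PairwiseDisjoint fun i => Ico (s i) (s i + w i)
  biUnion_eq : ⋃ i ∈ S, Ico (s i) (s i + w i) = Ico 0 (∑ i ∈ S, w i)

namespace IsTiling

variable {ι : Type*} {S : Finset ι} {s w : ι → ℝ}

theorem Ico_subset (hs : IsTiling S s w) {i : ι} (hi : i ∈ S) :
    Ico (s i) (s i + w i) ⊆ Ico 0 (∑ i ∈ S, w i) :=
  hs.biUnion_eq ▸ subset_biUnion_of_mem (u := fun i => Ico (s i) (s i + w i)) hi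

theorem nonneg_and_le (hs : IsTiling S s w) {i : ι} (hi : i ∈ S) (hw : 0 < w i) :
    0 ≤ s i ∧ s i + w i ≤ ∑ i ∈ S, w i :=
  (Ico_subset_Ico_iff (lt_add_of_pos_right _ hw)).1 (hs.Ico_subset hi)

theorem exists_mem_Ico (hs : IsTiling S s w) {x : ℝ} (hx : x ∈ Ico 0 (∑ i ∈ S, w i)) :
    ∃ i ∈ S, x ∈ Ico (s i) (s i + w i) := by
  simpa only [← hs.biUnion_eq, mem_iUnion, exists_prop] using hx

protected theorem insert [DecidableEq ι] (hs : IsTiling S s w) {i : ι} (hi : i ∉ S)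
    (hw : ∀ j ∈ insert i S, 0 ≤ w j) :
    IsTiling (insert i S) (Function.update s i (∑ j ∈ S, w j)) w := by
  simp only [Finset.forall_mem_insert] at hw
  have hne j (hj : j ∈ S) : j ≠ i := ne_of_mem_of_not_mem hj hi
  have hU : ⋃ j ∈ S, Ico (Function.update s i (∑ j ∈ S, w j) j)
      (Function.update s i (∑ j ∈ S, w j) j + w j) = Ico 0 (∑ j ∈ S, w j) := by
    rw [← hs.biUnion_eq]
    exact iUnion₂_congr fun j hj => by rw [Function.update_of_ne (hne j hj)]
  refine ⟨?_, ?_⟩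
  · rw [Finset.coe_insert]
    refine PairwiseDisjoint.insert (fun j hj l hl hjl => ?_) fun j hj _ => ?_
    · simpa only [Function.onFun, Function.update_of_ne (hne j hj),
        Function.update_of_ne (hne l hl)] using hs.pairwiseDisjoint hj hl hjl
    · rw [Function.update_self, Function.update_of_ne (hne j hj)]
      exact (Ico_disjoint_Ico_same.mono_left (hs.Ico_subset hj)).symm
  · rw [Finset.set_biUnion_insert, hU, Function.update_self, union_comm, Finset.sum_insert hi,
      add_comm (w i), Ico_union_Ico_eq_Ico (Finset.sum_nonneg hw.2) (le_add_of_nonneg_right hw.1)]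

end IsTiling

theorem exists_isTiling_antitone {ι : Type*} {S : Finset ι} {w : ι → ℝ} (hw : ∀ i ∈ S, 0 ≤ w i)
    (h : ι → ℝ) :
    ∃ s, IsTiling S s w ∧ ∀ i ∈ S, ∀ j ∈ S, ∀ x ∈ Ico (s i) (s i + w i),
      ∀ y ∈ Ico (s j) (s j + w j), x ≤ y → h j ≤ h i := by
  classical
  induction S using Finset.induction_on_min_value h with
  | empty => exact ⟨0, ⟨by simp, by simp⟩, by simp⟩
  | insert a S ha hmin ih =>
    obtain ⟨s, hs, hanti⟩ := ih fun i hi => hw i (Finset.mem_insert_of_mem hi)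
    refine ⟨_, hs.insert ha hw, ?_⟩
    have hne j (hj : j ∈ S) : j ≠ a := ne_of_mem_of_not_mem hj ha
    intro i hi j hj x hx y hy hxy
    rcases Finset.mem_insert.1 hj with rfl | hjS
    · rcases Finset.mem_insert.1 hi with rfl | hi
      exacts [le_rfl, hmin i hi]
    rw [Function.update_of_ne (hne j hjS)] at hy
    rcases Finset.mem_insert.1 hi with rfl | hi
    · rw [Function.update_self] at hx
      linarith [hx.1, (hs.Ico_subset hjS hy).2]
    · rw [Function.update_of_ne (hne i hi)] at hx
      exact hanti i hi j hjS x hx y hy hxy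

/-- A slice of a rectangle, assigned to a slot of a packing and placed at the horizontal offset
`left` of that slot. -/
structure Piece (α : Type*) where
  slot : α
  left : ℝ
  width : ℝ
  height : ℝ

namespace Piece

variable {α : Type*}

/-- The slice, without its position. -/
def rect (p : Piece α) : Rect := ⟨p.width, p.height⟩

/-- Two pieces do not overlap if they lie in the same slot. -/
def Compatible (p p' : Piece α) : Prop :=
  p.slot = p'.slot →
    Disjoint (Ico p.left (p.left + p.width)) (Ico p'.left (p'.left + p'.width))

theorem Compatible.symm {p p' : Piece α} (h : p.Compatible p') : p'.Compatible p :=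
  fun hslot => (h hslot.symm).symm

/-- The cells `[c γ, (c + 1) γ)` of a line correspond to the leftmost parts, of width `γ`, of the
slots `cell c`. The piece lies in one of these parts, and on the line it lies in `I`. -/
def InCells {C : ℕ} (cell : Fin C → α) (γ : ℝ) (I : Set ℝ) (p : Piece α) : Prop :=
  ∃ c : Fin C, p.slot = cell c ∧ 0 ≤ p.left ∧ 0 < p.width ∧ p.left + p.width ≤ γ ∧
    Ico (c * γ + p.left) (c * γ + p.left + p.width) ⊆ I

theorem InCells.mono {C : ℕ} {cell : Fin C → α} {γ : ℝ} {I J : Set ℝ} (hIJ : I ⊆ J) {p : Piece α}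
    (hp : p.InCells cell γ I) : p.InCells cell γ J := by
  obtain ⟨c, hc, h0, hw, hγ, hI⟩ := hp
  exact ⟨c, hc, h0, hw, hγ, hI.trans hIJ⟩

theorem InCells.compatible {C : ℕ} {cell : Fin C → α} (hcell : cell.Injective) {γ : ℝ} {I J : Set ℝ}
    (hIJ : Disjoint I J) {p p' : Piece α} (hp : p.InCells cell γ I) (hp' : p'.InCells cell γ J) :
    p.Compatible p' := by
  obtain ⟨c, hc, -, -, -, hI⟩ := hp
  obtain ⟨c', hc', -, -, -, hJ⟩ := hp'
  intro hslot
  obtain rfl : c = c' := hcell (hc.symm.trans (hslot.trans hc'))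
  refine disjoint_left.2 fun x hx hx' =>
    disjoint_left.1 hIJ (hI (?_ : (c : ℕ) * γ + x ∈ _)) (hJ ?_)
  · exact ⟨by linarith [hx.1], by linarith [hx.2]⟩
  · exact ⟨by linarith [hx'.1], by linarith [hx'.2]⟩

end Piece

/-- The pieces `L` are slices of height `h`, laid out on the part `I` of a line that is divided
into the cells `[c γ, (c + 1) γ)`. -/
structure IsLayout {α : Type*} {C : ℕ} (cell : Fin C → α) (γ h : ℝ) (I : Set ℝ)
    (L : List (Piece α)) : Prop where
  compatible : L.Pairwise Piece.Compatible
  inCells : ∀ p ∈ L, p.InCells cell γ I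
  height_eq : ∀ p ∈ L, p.height = h

namespace IsLayout

variable {α : Type*} {C : ℕ} {cell : Fin C → α} {γ h : ℝ}

theorem append (hcell : cell.Injective) {s m e : ℝ} {L L' : List (Piece α)} (hsm : s ≤ m)
    (hme : m ≤ e) (hL : IsLayout cell γ h (Ico s m) L) (hL' : IsLayout cell γ h (Ico m e) L') :
    IsLayout cell γ h (Ico s e) (L ++ L') where
  compatible := List.pairwise_append.2 ⟨hL.compatible, hL'.compatible, fun p hp p' hp' =>
    (hL.inCells p hp).compatible hcell Ico_disjoint_Ico_same (hL'.inCells p' hp')⟩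
  inCells := List.forall_mem_append.2
    ⟨fun p hp => (hL.inCells p hp).mono (Ico_subset_Ico_right hme),
      fun p hp => (hL'.inCells p hp).mono (Ico_subset_Ico_left hsm)⟩
  height_eq := List.forall_mem_append.2 ⟨hL.height_eq, hL'.height_eq⟩

theorem singleton (c : Fin C) {s w : ℝ} (hw : 0 < w) (hs : c * γ ≤ s)
    (hsw : s + w ≤ c * γ + γ) :
    IsLayout cell γ h (Ico s (s + w)) [⟨cell c, s - c * γ, w, h⟩] where
  compatible := List.pairwise_singleton _ _
  inCells := List.forall_mem_singleton.2 ⟨c, rfl, sub_nonneg.2 hs, hw, by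
    dsimp only; linarith, by dsimp only; rw [add_sub_cancel]⟩
  height_eq := List.forall_mem_singleton.2 rfl

theorem of_castSucc {cell : Fin (C + 1) → α} {I : Set ℝ} {L : List (Piece α)}
    (hL : IsLayout (cell ∘ Fin.castSucc) γ h I L) : IsLayout cell γ h I L where
  compatible := hL.compatible
  inCells p hp := by
    obtain ⟨c, hc⟩ := hL.inCells p hp
    exact ⟨c.castSucc, hc⟩
  height_eq := hL.height_eq

end IsLayout

theorem exists_vertical_slicing {α : Type*} (horiz : Prop) {C : ℕ} {cell : Fin C → α}
    (hcell : cell.Injective) {γ s w : ℝ} (h : ℝ) (hs : 0 ≤ s) (hw : 0 < w) (hC : s + w ≤ C * γ) :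
    ∃ L, Slicing horiz ⟨w, h⟩ (L.map Piece.rect) ∧ IsLayout cell γ h (Ico s (s + w)) L := by
  induction C generalizing w with
  | zero =>
    rw [Nat.cast_zero, zero_mul] at hC
    linarith
  | succ C ih =>
    have hcell' := hcell.comp (Fin.castSucc_injective C)
    rw [Nat.cast_succ, add_one_mul] at hC
    rcases le_or_gt (s + w) (C * γ) with hle | hlt
    · obtain ⟨L, hL, hlay⟩ := ih hcell' hw hle
      exact ⟨L, hL, hlay.of_castSucc⟩
    rcases le_or_gt (C * γ) s with hCs | hsC
    · exact ⟨_, .uncut _, .singleton (Fin.last C) hw (by simpa using hCs) (by simpa using hC)⟩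
    obtain ⟨L, hL, hlay⟩ := ih hcell' (w := C * γ - s) (by linarith) (by linarith)
    rw [add_sub_cancel] at hlay
    have hlast := IsLayout.singleton (cell := cell) (γ := γ) (h := h) (Fin.last C)
      (s := C * γ) (w := s + w - C * γ) (by linarith) (by simp) (by simp; linarith)
    rw [add_sub_cancel] at hlast
    refine ⟨_, ?_, hlay.of_castSucc.append hcell hsC.le hlt.le hlast⟩
    have hcut := Slicing.vert (sub_pos.2 hsC) (sub_pos.2 hlt) hL (.uncut _)
    rw [show C * γ - s + (s + w - C * γ) = w by ring] at hcut
    rw [List.map_append]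
    exact hcut

theorem exists_strip_slicing {α : Type*} {horiz : Prop} {C : ℕ} {cell : Fin C → α}
    (hcell : cell.Injective) {γ s w h : ℝ} (hh : 0 < h) {n : ℕ} (hn : 1 ≤ n)
    (hhor : 1 < n → horiz) (hs : 0 ≤ s) (hw : 0 < w) (hC : s + n * w ≤ C * γ) :
    ∃ L, Slicing horiz ⟨w, n * h⟩ (L.map Piece.rect) ∧
      IsLayout cell γ h (Ico s (s + n * w)) L := by
  induction n, hn using Nat.le_induction with
  | base =>
    simp only [Nat.cast_one, one_mul] at hC ⊢
    exact exists_vertical_slicing horiz hcell h hs hw hC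
  | succ n hn ih =>
    rw [Nat.cast_succ, add_one_mul (n : ℝ) w, ← add_assoc] at hC
    rw [Nat.cast_succ, add_one_mul (n : ℝ) w, ← add_assoc, add_one_mul]
    obtain ⟨L, hL, hlay⟩ := ih (fun _ => hhor (by lia)) (by linarith)
    obtain ⟨M, hM, hlayM⟩ := exists_vertical_slicing horiz hcell (s := s + n * w) h
      (by positivity) hw hC
    refine ⟨L ++ M, ?_, hlay.append hcell (by nlinarith) (by linarith) hlayM⟩
    rw [List.map_append]
    exact .horz (hhor (by lia)) (by positivity) hh hL hM

/-! ### Packing slices into strips -/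

theorem disjoint_openRect_of_disjoint_left {x y x' y' : ℝ} {r r' : Rect}
    (h : Disjoint (Ico x (x + r.width)) (Ico x' (x' + r'.width))) :
    Disjoint (openRect x y r) (openRect x' y' r') :=
  disjoint_prod.2 <| .inl <| h.mono Ioo_subset_Ico_self Ioo_subset_Ico_self

theorem disjoint_openRect_of_disjoint_bot {x y x' y' : ℝ} {r r' : Rect}
    (h : Disjoint (Ico y (y + r.height)) (Ico y' (y' + r'.height))) :
    Disjoint (openRect x y r) (openRect x' y' r') :=
  disjoint_prod.2 <| .inr <| h.mono Ioo_subset_Ico_self Ioo_subset_Ico_self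

/-- Non-overlapping horizontal strips of width `1` in unit squares indexed by `β`. They serve both
as shelves for the large items and as slots for the slices of the small items. -/
structure StripSystem (α β : Type*) where
  bin : α → β
  bot : α → ℝ
  height : α → ℝ
  height_pos : ∀ a, 0 < height a
  inside : ∀ a, 0 ≤ bot a ∧ bot a + height a ≤ 1
  disjoint : ∀ a a', a ≠ a' → bin a = bin a' →
    Disjoint (Ico (bot a) (bot a + height a)) (Ico (bot a') (bot a' + height a'))

theorem exists_stripSystem {α β : Type*} [Fintype α] [DecidableEq β] (bin : α → β) {height : α → ℝ}
    (hpos : ∀ a, 0 < height a) (hbin : ∀ t, ∑ a with bin a = t, height a ≤ 1) :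
    ∃ F : StripSystem α β, F.bin = bin ∧ F.height = height := by
  choose s hs _ using fun t => exists_isTiling_antitone
    (S := Finset.univ.filter fun a => bin a = t) (fun a _ => (hpos a).le) 0
  have hmem a : a ∈ Finset.univ.filter fun a' => bin a' = bin a := by simp
  refine ⟨⟨bin, fun a => s (bin a) a, height, hpos, fun a => ?_, fun a a' hne hb => ?_⟩, rfl, rfl⟩
  · obtain ⟨h0, hle⟩ := (hs (bin a)).nonneg_and_le (hmem a) (hpos a)
    exact ⟨h0, hle.trans (hbin _)⟩
  · have hdis := (hs (bin a)).pairwiseDisjoint (hmem a) (by simp [hb]) hne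
    rwa [hb] at hdis ⊢

/-- The pieces `L i`, for `i ∈ S`, are slices of the rectangles `K i`, with horizontal cuts only if
`horiz i` holds. They stand side by side in strips of width `1`, a strip `a` having height
`height a`, the strips of the pieces of `K i` being in `T i`. -/
structure IsPlacement {ι α : Type*} (T : ι → Set α) (height : α → ℝ) (horiz : ι → Prop)
    (K : ι → Rect) (S : Set ι) (L : ι → List (Piece α)) : Prop where
  slicing : ∀ i ∈ S, Slicing (horiz i) (K i) ((L i).map Piece.rect)
  slot_mem : ∀ i ∈ S, ∀ p ∈ L i, p.slot ∈ T i
  inside : ∀ i ∈ S, ∀ p ∈ L i, 0 ≤ p.left ∧ p.left + p.width ≤ 1 ∧ p.height ≤ height p.slot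
  compatible : ∀ i ∈ S, (L i).Pairwise Piece.Compatible
  pairwise : S.Pairwise fun i i' => ∀ p ∈ L i, ∀ p' ∈ L i', p.Compatible p'

section Placement

variable {ι α : Type*} {T : ι → Set α} {height : α → ℝ} {horiz : ι → Prop} {K : ι → Rect}
  {S : Set ι}

theorem exists_isPlacement {C : ℕ} {cell : Fin C → α} (hcell : cell.Injective)
    (hT : ∀ i ∈ S, ∀ c, cell c ∈ T i) {γ : ℝ} (hγ : γ ≤ 1) {I : ι → Set ℝ}
    (hI : S.PairwiseDisjoint I) {h : ι → ℝ}
    (hfit : ∀ i ∈ S, ∀ x ∈ I i, ∀ c : Fin C, c * γ ≤ x → h i ≤ height (cell c))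
    (hL : ∀ i ∈ S, ∃ L, Slicing (horiz i) (K i) (L.map Piece.rect) ∧
      IsLayout cell γ (h i) (I i) L) :
    ∃ L, IsPlacement T height horiz K S L := by
  choose! L hsl hlay using hL
  refine ⟨L, hsl, fun i hi p hp => ?_, fun i hi p hp => ?_, fun i hi => (hlay i hi).compatible,
    fun i hi i' hi' hne p hp p' hp' => ((hlay i hi).inCells p hp).compatible hcell (hI hi hi' hne)
      ((hlay i' hi').inCells p' hp')⟩
  all_goals obtain ⟨c, hc, h0, hw, hle, hsub⟩ := (hlay i hi).inCells p hp
  · exact hc ▸ hT i hi c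
  · refine ⟨h0, hle.trans hγ, ?_⟩
    rw [(hlay i hi).height_eq p hp, hc]
    exact hfit i hi _ (hsub (left_mem_Ico.2 (lt_add_of_pos_right _ hw))) c
      (le_add_of_nonneg_right h0)

open Classical in
theorem IsPlacement.piecewise {L L' : ι → List (Piece α)} (hL : IsPlacement T height horiz K S L)
    (hL' : IsPlacement T height horiz K Sᶜ L')
    (hT : ∀ i ∈ S, ∀ i' ∈ Sᶜ, Disjoint (T i) (T i')) :
    IsPlacement T height horiz K univ (S.piecewise L L') where
  slicing i _ := by
    by_cases hi : i ∈ S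
    · simpa [hi] using hL.slicing i hi
    · simpa [hi] using hL'.slicing i hi
  slot_mem i _ := by
    by_cases hi : i ∈ S
    · simpa [hi] using hL.slot_mem i hi
    · simpa [hi] using hL'.slot_mem i hi
  inside i _ := by
    by_cases hi : i ∈ S
    · simpa [hi] using hL.inside i hi
    · simpa [hi] using hL'.inside i hi
  compatible i _ := by
    by_cases hi : i ∈ S
    · simpa [hi] using hL.compatible i hi
    · simpa [hi] using hL'.compatible i hi
  pairwise i _ i' _ hne := by
    have hcross {i i'} (hi : i ∈ S) (hi' : i' ∉ S) {p p'} (hp : p ∈ L i) (hp' : p' ∈ L' i') :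
        p.slot ≠ p'.slot :=
      (hT i hi i' hi').ne_of_mem (hL.slot_mem i hi p hp) (hL'.slot_mem i' hi' p' hp')
    by_cases hi : i ∈ S <;> by_cases hi' : i' ∈ S <;>
      simp only [hi, hi', not_false_eq_true, piecewise_eq_of_mem, piecewise_eq_of_notMem]
    · exact hL.pairwise hi hi' hne
    · exact fun p hp p' hp' hslot => absurd hslot (hcross hi hi' hp hp')
    · exact fun p hp p' hp' hslot => absurd hslot.symm (hcross hi' hi hp' hp)
    · exact hL'.pairwise hi hi' hne

end Placement

/-- The piece whose rectangle is a given slice. -/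
def pieceAt {ι α : Type*} (L : ι → List (Piece α))
    (s : SliceIdx fun i => (L i).map Piece.rect) : Piece α :=
  (L s.1).get (s.2.cast (List.length_map _))

theorem pieceAt_mem {ι α : Type*} (L : ι → List (Piece α))
    (s : SliceIdx fun i => (L i).map Piece.rect) : pieceAt L s ∈ L s.1 :=
  List.get_mem _ _

theorem sliceRect_map_rect {ι α : Type*} (L : ι → List (Piece α))
    (s : SliceIdx fun i => (L i).map Piece.rect) :
    sliceRect (fun i => (L i).map Piece.rect) s = (pieceAt L s).rect := by
  simp [sliceRect, pieceAt]

theorem IsPlacement.compatible_pieceAt {ι α : Type*} {T : ι → Set α} {height : α → ℝ}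
    {horiz : ι → Prop} {K : ι → Rect} {L : ι → List (Piece α)}
    (hL : IsPlacement T height horiz K univ L) {s s' : SliceIdx fun i => (L i).map Piece.rect}
    (hne : s ≠ s') : (pieceAt L s).Compatible (pieceAt L s') := by
  obtain ⟨i, a⟩ := s
  obtain ⟨i', a'⟩ := s'
  rcases eq_or_ne i i' with rfl | hii
  · have hP := List.pairwise_iff_get.1 (hL.compatible i trivial)
    rcases lt_or_gt_of_ne fun h : a = a' => hne (by rw [h]) with h | h
    exacts [hP _ _ h, (hP _ _ h).symm]
  · exact hL.pairwise trivial trivial hii _ (List.get_mem _ _) _ (List.get_mem _ _)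

theorem StripSystem.disjoint_openRect {α β : Type*} (F : StripSystem α β) {a a' : α} (hne : a ≠ a')
    (hb : F.bin a = F.bin a') {x x' : ℝ} {r r' : Rect} (hr : r.height ≤ F.height a)
    (hr' : r'.height ≤ F.height a') :
    Disjoint (openRect x (F.bot a) r) (openRect x' (F.bot a') r') :=
  disjoint_openRect_of_disjoint_bot <| (F.disjoint a a' hne hb).mono
    (Ico_subset_Ico_right (by gcongr)) (Ico_subset_Ico_right (by gcongr))

theorem exists_shelfPacking_of_isPlacement {ι β τ : Type*} [Fintype β] {δ : ℝ} {K : ι → Rect}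
    {C : ℕ} (F : StripSystem (Fin C ⊕ τ) β) {L : ι → List (Piece (Fin C ⊕ τ))}
    (hL : IsPlacement (fun i => {a | a.isLeft ↔ δ < (K i).height}) F.height
      (fun i => (K i).height ≤ δ) K univ L) :
    ∃ P : ShelfPacking δ K (Fintype.card β), ∀ t, ∃ c, P.shelfHeight t = F.height (.inl c) := by
  let e := Fintype.equivFin β
  have hslot s := hL.slot_mem s.1 trivial _ (pieceAt_mem L s)
  have hinside s := hL.inside s.1 trivial _ (pieceAt_mem L s)
  refine ⟨{
    slices := fun i => (L i).map Piece.rect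
    slicing := fun i => hL.slicing i trivial
    numShelves := C
    shelfHeight := fun c => F.height (.inl c)
    shelfBin := fun c => e (F.bin (.inl c))
    shelfBot := fun c => F.bot (.inl c)
    shelf_pos := fun c => F.height_pos _
    shelf_inside := fun c => F.inside _
    shelf_disjoint := fun c c' hne hb =>
      F.disjoint_openRect (Sum.inl_injective.ne hne) (e.injective hb) le_rfl le_rfl
    bin := fun s => e (F.bin (pieceAt L s).slot)
    left := fun s => (pieceAt L s).left
    bot := fun s => F.bot (pieceAt L s).slot
    inside := fun s => ?_
    disjoint := fun s s' hne hb => ?_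
    large := fun s hs => ?_
    small := fun s hs c hb => ?_ }, fun c => ⟨c, rfl⟩⟩
  · obtain ⟨h0, hw, hh⟩ := hinside s
    rw [sliceRect_map_rect]
    exact ⟨h0, hw, (F.inside _).1, (add_le_add_right hh _).trans (F.inside _).2⟩
  · rw [sliceRect_map_rect, sliceRect_map_rect]
    by_cases hss : (pieceAt L s).slot = (pieceAt L s').slot
    · exact disjoint_openRect_of_disjoint_left (hL.compatible_pieceAt hne hss)
    · exact F.disjoint_openRect hss (e.injective hb) (hinside s).2.2 (hinside s').2.2
  · obtain ⟨c, hc⟩ := Sum.isLeft_iff.1 ((hslot s).2 hs)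
    refine ⟨c, congrArg (e ∘ F.bin) hc.symm, congrArg F.bot hc.symm, ?_⟩
    rw [sliceRect_map_rect, ← hc]
    exact (hinside s).2.2
  · rw [sliceRect_map_rect]
    refine F.disjoint_openRect (fun hc => ?_) (e.injective hb.symm) (hinside s).2.2 le_rfl
    exact hs.not_gt ((hslot s).1 (hc ▸ rfl))

theorem exists_sum_ceil_mul_le_sum_floor {ι β : Type*} (S : Finset ι) (B : Finset β) {w h : ι → ℝ}
    {v : β → ℝ} (hh : ∀ i ∈ S, 0 ≤ h i) (hv : ∀ t ∈ B, 0 ≤ v t)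
    (hlt : ∑ i ∈ S, w i * h i < ∑ t ∈ B, v t) :
    ∃ x : ℝ, 0 < x ∧ ∑ i ∈ S, ⌈h i * x⌉₊ * w i ≤ ∑ t ∈ B, ⌊v t * x⌋₊ := by
  have hceil : Tendsto (fun x : ℝ => ∑ i ∈ S, w i * (⌈h i * x⌉₊ / x)) atTop
      (𝓝 (∑ i ∈ S, w i * h i)) :=
    tendsto_finsetSum _ fun i hi => (tendsto_nat_ceil_mul_div_atTop (hh i hi)).const_mul _
  have hfloor : Tendsto (fun x : ℝ => ∑ t ∈ B, (⌊v t * x⌋₊ / x : ℝ)) atTop (𝓝 (∑ t ∈ B, v t)) :=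
    tendsto_finsetSum _ fun t ht => tendsto_nat_floor_mul_div_atTop (hv t ht)
  obtain ⟨x, hx, hx0⟩ := ((hceil.eventually_lt hfloor hlt).and (eventually_gt_atTop 0)).exists
  refine ⟨x, hx0, ?_⟩
  simp only [mul_div_left_comm (w _), ← mul_div_assoc, ← Finset.sum_div] at hx
  rw [div_lt_div_iff_of_pos_right hx0] at hx
  push_cast
  convert hx.le using 2

theorem card_filter_sigma_fst {β : Type*} [Fintype β] [DecidableEq β] (n : β → ℕ) (t : β) :
    (Finset.univ.filter fun p : Σ t, Fin (n t) => p.1 = t).card = n t := by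
  rw [← Fintype.card_subtype, Fintype.card_congr (Equiv.sigmaSubtype t), Fintype.card_fin]

theorem exists_free_strips {β : Type*} [Finite β] [DecidableEq β] {C : ℕ} {bin : Fin C → β}
    {H : Fin C → ℝ} (hH : ∀ c, 0 < H c) (hbin : ∀ t, ∑ c with bin c = t, H c ≤ 1) {x : ℝ}
    (hx : 0 < x) :
    ∃ F : StripSystem (Fin C ⊕ Σ t, Fin ⌊(1 - ∑ c with bin c = t, H c) * x⌋₊) β,
      F.height = Sum.elim H fun _ => 1 / x := by
  cases nonempty_fintype β
  have hfill t : ∑ a : Fin C ⊕ Σ t, Fin ⌊(1 - ∑ c with bin c = t, H c) * x⌋₊ with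
      Sum.elim bin Sigma.fst a = t, Sum.elim H (fun _ => 1 / x) a ≤ 1 := by
    rw [Finset.sum_filter, Fintype.sum_sum_type]
    change (∑ c, if bin c = t then H c else 0) + (∑ p, if Sigma.fst p = t then 1 / x else 0) ≤ 1
    rw [← Finset.sum_filter, ← Finset.sum_filter, Finset.sum_const, card_filter_sigma_fst,
      nsmul_eq_mul, ← le_sub_iff_add_le', mul_one_div, div_le_iff₀ hx]
    exact Nat.floor_le (mul_nonneg (sub_nonneg.2 (hbin t)) hx.le)
  obtain ⟨F, -, hF⟩ :=
    exists_stripSystem _ (Sum.forall.2 ⟨hH, fun _ => one_div_pos.2 hx⟩) hfill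
  exact ⟨F, hF⟩

theorem exists_isPlacement_of_le {ι α : Type*} [Fintype ι] {K : ι → Rect} {T : ι → Set α}
    {height : α → ℝ} {C : ℕ} {cell : Fin C → α} (hcell : cell.Injective) {S : Set ι}
    [DecidablePred (· ∈ S)] (hT : ∀ i ∈ S, ∀ c, cell c ∈ T i) (hw : ∀ i, 0 < (K i).width)
    (hh : ∀ i, 0 < (K i).height) {x : ℝ} (hx : 0 < x) (hheight : ∀ c, height (cell c) = 1 / x)
    (hC : ∑ i with i ∈ S, ⌈(K i).height * x⌉₊ * (K i).width ≤ C) {horiz : ι → Prop}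
    (hhoriz : ∀ i ∈ S, horiz i) : ∃ L, IsPlacement T height horiz K S L := by
  have hn i : 0 < ⌈(K i).height * x⌉₊ := Nat.ceil_pos.2 (mul_pos (hh i) hx)
  have hpos i : 0 < (⌈(K i).height * x⌉₊ : ℝ) * (K i).width :=
    mul_pos (Nat.cast_pos.2 (hn i)) (hw i)
  obtain ⟨s, hs, -⟩ := exists_isTiling_antitone (S := Finset.univ.filter (· ∈ S))
    (fun i _ => (hpos i).le) 0
  have hmem i (hi : i ∈ S) : i ∈ Finset.univ.filter (· ∈ S) := by simpa using hi
  refine exists_isPlacement (h := fun i => (K i).height / ⌈(K i).height * x⌉₊) hcell hT le_rfl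
    (hs.pairwiseDisjoint.subset fun i hi => hmem i hi) (fun i _ _ _ c _ => ?_) fun i hi => ?_
  · rw [hheight, div_le_div_iff₀ (Nat.cast_pos.2 (hn i)) hx, one_mul]
    exact Nat.le_ceil _
  · obtain ⟨h0, hle⟩ := hs.nonneg_and_le (hmem i hi) (hpos i)
    have hcut := exists_strip_slicing (horiz := horiz i) hcell (γ := 1)
      (div_pos (hh i) (Nat.cast_pos.2 (hn i))) (hn i) (fun _ => hhoriz i hi) h0 (hw i)
      (by linarith)
    rwa [mul_div_cancel₀ _ (Nat.cast_pos.2 (hn i)).ne'] at hcut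

open Classical in
theorem exists_shelfPacking_of_area_lt {ι β : Type*} [Fintype ι] [Fintype β] [DecidableEq β] {δ : ℝ}
    {K : ι → Rect} (hw : ∀ i, 0 < (K i).width) (hh : ∀ i, 0 < (K i).height) {C : ℕ}
    {bin : Fin C → β} {H : Fin C → ℝ} (hH : ∀ c, 0 < H c)
    (hbin : ∀ t, ∑ c with bin c = t, H c ≤ 1) {γ : ℝ} (hγ : γ ≤ 1) {s : ι → ℝ}
    (hs : ∀ i, δ < (K i).height → 0 ≤ s i ∧ s i + (K i).width ≤ C * γ)
    (hdis : {i | δ < (K i).height}.PairwiseDisjoint fun i => Ico (s i) (s i + (K i).width))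
    (hfit : ∀ i, δ < (K i).height → ∀ x ∈ Ico (s i) (s i + (K i).width), ∀ c : Fin C,
      c * γ ≤ x → (K i).height ≤ H c)
    (harea : ∑ i with (K i).height ≤ δ, (K i).width * (K i).height <
      ∑ t, (1 - ∑ c with bin c = t, H c)) :
    ∃ P : ShelfPacking δ K (Fintype.card β), ∀ t, ∃ c, P.shelfHeight t = H c := by
  obtain ⟨x, hx, hrows⟩ := exists_sum_ceil_mul_le_sum_floor _ _ (fun i _ => (hh i).le)
    (fun t _ => sub_nonneg.2 (hbin t)) harea
  obtain ⟨F, hF⟩ := exists_free_strips hH hbin hx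
  obtain ⟨L, hL⟩ := exists_isPlacement (T := fun i => {a | a.isLeft ↔ δ < (K i).height})
    (height := F.height) (horiz := fun i => (K i).height ≤ δ) Sum.inl_injective
    (fun i hi c => by simpa using hi) hγ hdis (by simpa [hF] using hfit)
    fun i hi => exists_vertical_slicing _ Sum.inl_injective _ (hs i hi).1 (hw i) (hs i hi).2
  have hrows' : ∑ i with i ∈ {i | δ < (K i).height}ᶜ, ⌈(K i).height * x⌉₊ * (K i).width ≤
      Fintype.card (Σ t, Fin ⌊(1 - ∑ c with bin c = t, H c) * x⌋₊) := by
    simpa using hrows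
  obtain ⟨L', hL'⟩ := exists_isPlacement_of_le (T := fun i => {a | a.isLeft ↔ δ < (K i).height})
    (height := F.height) (S := {i | δ < (K i).height}ᶜ) (horiz := fun i => (K i).height ≤ δ)
    (Sum.inr_injective.comp (Fintype.equivFin _).symm.injective)
    (fun i hi c => by simpa using hi) hw hh hx (by simp [hF]) hrows'
    fun i hi => not_lt.1 hi
  obtain ⟨P, hP⟩ := exists_shelfPacking_of_isPlacement F (hL.piecewise hL' fun i hi i' hi' =>
    disjoint_left.2 fun a ha ha' => hi' (ha'.1 (ha.2 hi)))
  exact ⟨P, by simpa [hF] using hP⟩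

theorem exists_card_fiber_le {β : Type*} [Fintype β] [DecidableEq β] {M : ℕ} {cnt : β → ℕ}
    (h : M ≤ ∑ t, cnt t) :
    ∃ f : Fin M → β, ∀ t, (Finset.univ.filter fun a => f a = t).card ≤ cnt t := by
  obtain ⟨e⟩ := Function.Embedding.nonempty_of_card_le (α := Fin M) (β := Σ t, Fin (cnt t))
    (by simpa using h)
  refine ⟨fun a => (e a).1, fun t => ?_⟩
  calc _ ≤ (Finset.univ.filter fun p : Σ t, Fin (cnt t) => p.1 = t).card :=
        Finset.card_le_card_of_injOn e (by intro a; simp) e.injective.injOn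
    _ = cnt t := card_filter_sigma_fst cnt t

/-! ### Linear grouping -/

/-- Linear grouping of the items in `S`, of widths `w` and heights `h`, into `r + 1` groups of
width `g`: the items are laid out on a line from high to low, and group `j` occupies
`[j g, (j + 1) g)`. The item `rep j` at the left end of group `j` is a highest one of the group, and
`part i j` is the width of the part of item `i` in group `j`. The parts in the last group are not
recorded, for group `j` will take the heights of group `j + 1`. -/
structure LinearGrouping {ι : Type*} (S : Finset ι) (w h : ι → ℝ) (r : ℕ) (g : ℝ) where
  pos : ι → ℝ
  rep : Fin (r + 1) → ι
  part : ι → Fin r → ℝ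
  sum_width : ∑ i ∈ S, w i = (r + 1) * g
  isTiling : IsTiling S pos w
  rep_mem : ∀ j, rep j ∈ S
  le_rep : ∀ i ∈ S, ∀ y ∈ Ico (pos i) (pos i + w i), ∀ j : Fin (r + 1), j * g ≤ y →
    h i ≤ h (rep j)
  part_nonneg : ∀ i j, 0 ≤ part i j
  rep_succ_le : ∀ i ∈ S, ∀ j, part i j ≠ 0 → h (rep j.succ) ≤ h i
  sum_part_le : ∀ i ∈ S, ∑ j, part i j ≤ w i
  sum_part_eq : ∀ j, ∑ i ∈ S, part i j = g

open MeasureTheory in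
theorem sum_measureReal_inter_le {α κ : Type*} [Fintype κ] [MeasurableSpace α] {μ : Measure α}
    {A : Set α} (hA : μ A ≠ ⊤) (hmA : MeasurableSet A) {J : κ → Set α}
    (hJ : Pairwise (Function.onFun Disjoint J)) (hmJ : ∀ j, MeasurableSet (J j)) :
    ∑ j, μ.real (A ∩ J j) ≤ μ.real A := by
  rw [← measureReal_iUnion_fintype (fun j j' hne => (hJ hne).mono inter_subset_right
    inter_subset_right) (fun j => hmA.inter (hmJ j))
    fun j => measure_ne_top_of_subset inter_subset_left hA]
  exact measureReal_mono (iUnion_subset fun j => inter_subset_left) hA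

open MeasureTheory in
theorem IsTiling.sum_volume_inter {ι : Type*} {S : Finset ι} {s w : ι → ℝ} (hs : IsTiling S s w)
    {J : Set ℝ} (hmJ : MeasurableSet J) (hJ : J ⊆ Ico 0 (∑ i ∈ S, w i)) :
    ∑ i ∈ S, volume.real (Ico (s i) (s i + w i) ∩ J) = volume.real J := by
  rw [← measureReal_biUnion_finset (fun i hi i' hi' hne => (hs.pairwiseDisjoint hi hi' hne).mono
      inter_subset_left inter_subset_left) (fun i _ => measurableSet_Ico.inter hmJ)
      fun i _ => measure_ne_top_of_subset inter_subset_left measure_Ico_lt_top.ne,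
    ← iUnion₂_inter, hs.biUnion_eq, inter_eq_right.2 hJ]

open MeasureTheory in
theorem exists_linearGrouping {ι : Type*} {S : Finset ι} (hS : S.Nonempty) {w : ι → ℝ}
    (hw : ∀ i ∈ S, 0 < w i) (h : ι → ℝ) (r : ℕ) :
    Nonempty (LinearGrouping S w h r ((∑ i ∈ S, w i) / (r + 1))) := by
  set g := (∑ i ∈ S, w i) / (r + 1)
  have hg : 0 < g := div_pos (Finset.sum_pos hw hS) (by positivity)
  have hsum : ∑ i ∈ S, w i = (r + 1) * g := (mul_div_cancel₀ _ (by positivity)).symm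
  obtain ⟨s, hs, hanti⟩ := exists_isTiling_antitone (fun i hi => (hw i hi).le) h
  have hrep (j : Fin (r + 1)) : ∃ i ∈ S, (j * g : ℝ) ∈ Ico (s i) (s i + w i) := by
    refine hs.exists_mem_Ico ⟨by positivity, ?_⟩
    rw [hsum]
    exact mul_lt_mul_of_pos_right (by exact_mod_cast j.2) hg
  choose rep hmem hrep using hrep
  let cell (j : Fin r) : Set ℝ := Ico (j * g) (j.succ * g)
  have hcell : Pairwise (Function.onFun Disjoint cell) := fun j j' hne => by
    have hmono : Monotone fun n : ℕ => (n * g : ℝ) := fun m n hmn => by dsimp only; gcongr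
    simpa [cell] using hmono.pairwise_disjoint_on_Ico_succ (Fin.val_injective.ne hne)
  refine ⟨⟨s, rep, fun i j => volume.real (Ico (s i) (s i + w i) ∩ cell j), hsum, hs, hmem,
    fun i hi y hy j hj => hanti _ (hmem j) i hi _ (hrep j) y hy hj, fun _ _ => measureReal_nonneg,
    fun i hi j hij => ?_, fun i hi => ?_, fun j => ?_⟩⟩
  · obtain ⟨x, hx, hxj⟩ : (Ico (s i) (s i + w i) ∩ cell j).Nonempty := by
      rw [nonempty_iff_ne_empty]
      exact fun he => hij (by rw [he, measureReal_empty])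
    exact hanti i hi _ (hmem _) x hx _ (hrep _) hxj.2.le
  · refine (sum_measureReal_inter_le measure_Ico_lt_top.ne measurableSet_Ico hcell
      fun j => measurableSet_Ico).trans_eq ?_
    rw [Real.volume_real_Ico_of_le (by linarith [hw i hi]), add_sub_cancel_left]
  · have hsub : cell j ⊆ Ico 0 (∑ i ∈ S, w i) := by
      rw [hsum]
      refine Ico_subset_Ico (by positivity) (mul_le_mul_of_nonneg_right ?_ hg.le)
      exact_mod_cast j.succ.2.le
    rw [hs.sum_volume_inter measurableSet_Ico hsub,
      Real.volume_real_Ico_of_le (by gcongr; simp), Fin.val_succ]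
    push_cast
    ring

namespace LinearGrouping

variable {ι : Type*} {S : Finset ι} {w h : ι → ℝ} {r : ℕ} {g : ℝ}

theorem sum_mul_le (G : LinearGrouping S w h r g) (hh : ∀ i ∈ S, 0 ≤ h i) :
    ∑ j : Fin r, g * h (G.rep j.succ) ≤ ∑ i ∈ S, w i * h i := by
  calc ∑ j : Fin r, g * h (G.rep j.succ)
      = ∑ i ∈ S, ∑ j, G.part i j * h (G.rep j.succ) := by
        rw [Finset.sum_comm]
        simp only [← Finset.sum_mul, G.sum_part_eq]
    _ ≤ ∑ i ∈ S, ∑ j, G.part i j * h i := by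
        refine Finset.sum_le_sum fun i hi => Finset.sum_le_sum fun j _ => ?_
        rcases eq_or_ne (G.part i j) 0 with h0 | h0
        · simp [h0]
        · exact mul_le_mul_of_nonneg_left (G.rep_succ_le i hi j h0) (G.part_nonneg i j)
    _ ≤ ∑ i ∈ S, w i * h i := by
        simp only [← Finset.sum_mul]
        exact Finset.sum_le_sum fun i hi =>
          mul_le_mul_of_nonneg_right (G.sum_part_le i hi) (hh i hi)

theorem exists_configurations (G : LinearGrouping S w h r g) {a : ι → ℝ} (hh : ∀ i ∈ S, 0 < h i)
    (ha : ∀ i ∈ S, 0 ≤ a i ∧ a i + h i ≤ 1) {W : ℝ} (hW : 0 < W)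
    (hcov : ∀ y, ∑ i ∈ S with y ∈ Ioo (a i) (a i + h i), w i ≤ W) :
    ∃ (κ : Type) (_ : Fintype κ) (n : κ → Fin r → ℕ) (y : κ → ℝ), Fintype.card κ ≤ r + 1 ∧
      (∀ k, ∑ j, n k j * h (G.rep j.succ) ≤ 1) ∧ (∀ k, 0 < y k) ∧ ∑ k, y k = W ∧
      ∀ j, ∑ k, y k * n k j = g := by
  classical
  let P := (S ×ˢ (Finset.univ : Finset (Fin r))).filter fun p => G.part p.1 p.2 ≠ 0
  have hP p (hp : p ∈ P) : p.1 ∈ S ∧ G.part p.1 p.2 ≠ 0 := by simpa [P] using hp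
  have hcovP y : ∑ p ∈ P with y ∈ Ioo (a p.1) (a p.1 + h p.1), G.part p.1 p.2 ≤ W :=
    calc _ ≤ ∑ p ∈ (S.filter fun i => y ∈ Ioo (a i) (a i + h i)) ×ˢ Finset.univ,
          G.part p.1 p.2 :=
          Finset.sum_le_sum_of_subset_of_nonneg
            (fun p hp => by
              obtain ⟨hp, hy⟩ := Finset.mem_filter.1 hp
              simpa using ⟨(hP p hp).1, hy⟩)
            fun p _ _ => G.part_nonneg p.1 p.2
      _ ≤ ∑ i ∈ S with y ∈ Ioo (a i) (a i + h i), w i := by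
          rw [Finset.sum_product]
          exact Finset.sum_le_sum fun i hi => G.sum_part_le i (Finset.mem_filter.1 hi).1
      _ ≤ W := hcov y
  have hcol j : ∑ p ∈ P with p.2 = j, G.part p.1 p.2 = g := by
    refine Eq.trans ?_ (G.sum_part_eq j)
    rw [Finset.sum_filter, Finset.sum_filter_of_ne, Finset.sum_product]
    · simp
    · rintro p - hp h0
      simp [h0] at hp
  obtain ⟨κ, hκ, n, y, hcard, hn, hy, hsum, hyn⟩ := exists_interval_configurations (S := P)
    (a := fun p => a p.1) (e := fun p => a p.1 + h p.1) (w := fun p => G.part p.1 p.2)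
    (fun p hp => lt_add_of_pos_right _ (hh _ (hP p hp).1)) (fun p hp => ha _ (hP p hp).1)
    (fun p _ => G.part_nonneg p.1 p.2) hW hcovP (ty := Prod.snd)
    (h := fun j => h (G.rep j.succ)) fun p hp => by
      rw [add_sub_cancel_left]
      exact G.rep_succ_le _ (hP p hp).1 _ (hP p hp).2
  exact ⟨κ, hκ, n, y, hcard, hn, hy, hsum, fun j => (hyn j).trans (hcol j)⟩

end LinearGrouping

/-! ### Bins from configurations -/

theorem exists_bin_of_counts {β : Type*} [Fintype β] [DecidableEq β] {q M : ℕ} {H : Fin q → ℝ}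
    (hH : ∀ j, 0 ≤ H j) {cnt : β → Fin q → ℕ} (hcnt : ∀ j, M ≤ ∑ t, cnt t j) :
    ∃ bin : Fin (q * M) → β, ∀ t, ∑ c with bin c = t, H c.divNat ≤ ∑ j, cnt t j * H j := by
  choose f hf using fun j => exists_card_fiber_le (hcnt j)
  refine ⟨fun c => f c.divNat c.modNat, fun t => ?_⟩
  have hdiv (p : Fin q × Fin M) : (finProdFinEquiv p).divNat = p.1 :=
    congrArg Prod.fst (finProdFinEquiv.symm_apply_apply p)
  have hmod (p : Fin q × Fin M) : (finProdFinEquiv p).modNat = p.2 :=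
    congrArg Prod.snd (finProdFinEquiv.symm_apply_apply p)
  rw [Finset.sum_filter, ← finProdFinEquiv.sum_comp, Fintype.sum_prod_type]
  simp only [hdiv, hmod, ← Finset.sum_filter, Finset.sum_const, nsmul_eq_mul]
  gcongr with j
  exacts [hH j, hf j t]

theorem exists_configuration_bins {κ : Type*} [Fintype κ] [DecidableEq κ] {r : ℕ}
    {H : Fin (r + 1) → ℝ} (hH : ∀ j, 0 ≤ H j) (hH0 : H 0 ≤ 1) {n : κ → Fin r → ℕ}
    (hn : ∀ k, ∑ j, n k j * H j.succ ≤ 1) {y : κ → ℝ} {g : ℝ} (hy : ∀ j, ∑ k, y k * n k j = g) :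
    ∃ bin : Fin ((r + 1) * ⌈g⌉₊) → Fin ⌈g⌉₊ ⊕ Σ k, Fin ⌈y k⌉₊,
      (∀ t, ∑ c with bin c = t, H c.divNat ≤ 1) ∧
      ∑ k, y k - ∑ j : Fin r, g * H j.succ ≤ ∑ t, (1 - ∑ c with bin c = t, H c.divNat) := by
  -- The configuration `k` fills `⌈y k⌉` bins. The highest group, into which no group is shrunk,
  -- gets one shelf in each of `⌈g⌉` further bins.
  let cnt : (Fin ⌈g⌉₊ ⊕ Σ k, Fin ⌈y k⌉₊) → Fin (r + 1) → ℕ :=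
    Sum.elim (fun _ => Fin.cons 1 0) fun t => Fin.cons 0 (n t.1)
  have hcnt j : ⌈g⌉₊ ≤ ∑ t, cnt t j := by
    rw [Fintype.sum_sum_type, Fintype.sum_sigma]
    refine Fin.cases (by simp [cnt]) (fun j => ?_) j
    simp only [cnt, Sum.elim_inl, Sum.elim_inr, Fin.cons_succ, Pi.zero_apply, Finset.sum_const_zero,
      zero_add, Finset.sum_const, Finset.card_univ, Fintype.card_fin, smul_eq_mul]
    rw [Nat.ceil_le, ← hy j]
    push_cast
    gcongr
    exact Nat.le_ceil _
  have hinl t : ∑ j, cnt (.inl t) j * H j = H 0 := by simp [cnt, Fin.sum_univ_succ]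
  have hinr t : ∑ j, cnt (.inr t) j * H j = ∑ j, n t.1 j * H j.succ := by
    simp [cnt, Fin.sum_univ_succ]
  obtain ⟨bin, hbin⟩ := exists_bin_of_counts hH hcnt
  refine ⟨bin, fun t => (hbin t).trans ?_, ?_⟩
  · rcases t with t | t
    exacts [(hinl t).trans_le hH0, (hinr t).trans_le (hn t.1)]
  calc ∑ k, y k - ∑ j : Fin r, g * H j.succ
      = ∑ k, y k * (1 - ∑ j, n k j * H j.succ) := by
        simp only [mul_sub, mul_one, Finset.sum_sub_distrib, Finset.mul_sum, ← mul_assoc]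
        rw [Finset.sum_comm]
        simp only [← Finset.sum_mul, hy]
    _ ≤ ∑ k, ⌈y k⌉₊ * (1 - ∑ j, n k j * H j.succ) := by
        refine Finset.sum_le_sum fun k _ => ?_
        exact mul_le_mul_of_nonneg_right (Nat.le_ceil _) (sub_nonneg.2 (hn k))
    _ ≤ ∑ t, (1 - ∑ j, cnt t j * H j) := by
        rw [Fintype.sum_sum_type, Fintype.sum_sigma]
        simp only [hinl, hinr, Finset.sum_const, Finset.card_univ, Fintype.card_fin, nsmul_eq_mul]
        exact le_add_of_nonneg_left (mul_nonneg (Nat.cast_nonneg _) (sub_nonneg.2 hH0))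
    _ ≤ ∑ t, (1 - ∑ c with bin c = t, H c.divNat) :=
        Finset.sum_le_sum fun t _ => sub_le_sub_left (hbin t) 1

theorem LinearGrouping.exists_shelfPacking {ι : Type*} [Fintype ι] {δ : ℝ} {K : ι → Rect}
    (hw : ∀ i, 0 < (K i).width) (hh : ∀ i, 0 < (K i).height ∧ (K i).height ≤ 1) {r : ℕ} {g : ℝ}
    (hg : 0 < g)
    (G : LinearGrouping (Finset.univ.filter fun i => δ < (K i).height) (fun i => (K i).width)
      (fun i => (K i).height) r g) {κ : Type*} [Fintype κ] {n : κ → Fin r → ℕ}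
    (hn : ∀ k, ∑ j, n k j * (K (G.rep j.succ)).height ≤ 1) {y : κ → ℝ}
    (hy : ∀ j, ∑ k, y k * n k j = g)
    (harea : ∑ i, (K i).width * (K i).height < ∑ k, y k) :
    ∃ P : ShelfPacking δ K (⌈g⌉₊ + ∑ k, ⌈y k⌉₊),
      ∀ t, ∃ j, P.shelfHeight t = (K (G.rep j)).height := by
  classical
  have hM : (0 : ℝ) < ⌈g⌉₊ := Nat.cast_pos.2 (Nat.ceil_pos.2 hg)
  have hγ : ⌈g⌉₊ * (g / ⌈g⌉₊) = g := mul_div_cancel₀ _ hM.ne'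
  obtain ⟨bin, hbin, hfree⟩ := exists_configuration_bins (fun j => (hh (G.rep j)).1.le)
    (hh (G.rep 0)).2 hn hy
  have hmem {i} (hi : δ < (K i).height) : i ∈ Finset.univ.filter fun i => δ < (K i).height := by
    simpa using hi
  have hsmall : ∑ i with (K i).height ≤ δ, (K i).width * (K i).height <
      ∑ t, (1 - ∑ c with bin c = t, (K (G.rep c.divNat)).height) := by
    have hsplit := Finset.sum_filter_add_sum_filter_not Finset.univ (fun i => δ < (K i).height)
      fun i => (K i).width * (K i).height
    simp only [not_lt] at hsplit
    linarith [G.sum_mul_le fun i _ => (hh i).1.le]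
  have hpos i (hi : δ < (K i).height) : 0 ≤ G.pos i ∧ G.pos i + (K i).width ≤
      ((r + 1) * ⌈g⌉₊ : ℕ) * (g / ⌈g⌉₊) := by
    rw [Nat.cast_mul, mul_assoc, hγ, Nat.cast_succ, ← G.sum_width]
    exact G.isTiling.nonneg_and_le (hmem hi) (hw i)
  have hfit i (hi : δ < (K i).height) x (hx : x ∈ Ico (G.pos i) (G.pos i + (K i).width))
      (c : Fin ((r + 1) * ⌈g⌉₊)) (hc : c * (g / ⌈g⌉₊) ≤ x) :
      (K i).height ≤ (K (G.rep c.divNat)).height := by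
    refine G.le_rep i (hmem hi) x hx c.divNat (le_trans ?_ hc)
    have hdiv : ((c.divNat : ℕ) : ℝ) * ⌈g⌉₊ ≤ (c : ℕ) := by
      exact_mod_cast Nat.div_mul_le_self _ _
    calc (c.divNat : ℕ) * g = (c.divNat : ℕ) * ⌈g⌉₊ * (g / ⌈g⌉₊) := by rw [mul_assoc, hγ]
      _ ≤ c * (g / ⌈g⌉₊) := by gcongr
  obtain ⟨P, hP⟩ := exists_shelfPacking_of_area_lt hw (fun i => (hh i).1) (fun c => (hh _).1) hbin
    (div_le_one_of_le₀ (Nat.le_ceil g) hM.le) hpos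
    (fun i hi i' hi' => G.isTiling.pairwiseDisjoint (hmem hi) (hmem hi')) hfit hsmall
  have hcard : Fintype.card (Fin ⌈g⌉₊ ⊕ Σ k, Fin ⌈y k⌉₊) = ⌈g⌉₊ + ∑ k, ⌈y k⌉₊ := by simp
  rw [← hcard]
  exact ⟨P, fun t => (hP t).imp' _ fun c hc => hc⟩

theorem ShelfPacking.isStructured_of_forall_exists {ι : Type*} {δ : ℝ} {K : ι → Rect} {N q : ℕ}
    (P : ShelfPacking δ K N) (hq : q ≤ ⌈1 / δ ^ 2⌉₊) {rep : Fin q → ι}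
    (hrep : ∀ j, δ < (K (rep j)).height)
    (hP : ∀ t, ∃ j, P.shelfHeight t = (K (rep j)).height) : P.IsStructured := by
  refine ⟨?_, fun t => ?_⟩
  · have hsub : range P.shelfHeight ⊆ range fun j => (K (rep j)).height := by
      rintro _ ⟨t, rfl⟩
      obtain ⟨j, hj⟩ := hP t
      exact ⟨j, hj.symm⟩
    calc (range P.shelfHeight).ncard ≤ (range fun j => (K (rep j)).height).ncard :=
          ncard_le_ncard hsub
      _ ≤ Nat.card (Fin q) := Finite.card_range_le _
      _ ≤ ⌈1 / δ ^ 2⌉₊ := by rwa [Nat.card_fin]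
  · obtain ⟨j, hj⟩ := hP t
    exact ⟨rep j, hrep j, hj⟩

theorem exists_structured_packing_of_small {ι : Type*} [Fintype ι] {δ : ℝ} {K : ι → Rect}
    (hw : ∀ i, 0 < (K i).width) (hh : ∀ i, 0 < (K i).height ∧ (K i).height ≤ δ) {N : ℕ}
    (harea : ∑ i, (K i).width * (K i).height < N) :
    ∃ P : ShelfPacking δ K N, P.IsStructured := by
  have hlarge i : ¬δ < (K i).height := (hh i).2.not_gt
  suffices ∃ P : ShelfPacking δ K (Fintype.card (Fin N)), P.IsStructured by
    rwa [Fintype.card_fin] at this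
  obtain ⟨P, hP⟩ := exists_shelfPacking_of_area_lt (β := Fin N) (δ := δ) hw (fun i => (hh i).1)
    (C := 0) (bin := Fin.elim0) (H := Fin.elim0) (fun c => c.elim0) (by simp) zero_le_one (s := 0)
    (fun i hi => absurd hi (hlarge i)) (fun i hi => absurd hi (hlarge i))
    (fun i hi => absurd hi (hlarge i)) (by simpa [hh] using harea)
  exact ⟨P, P.isStructured_of_forall_exists (Nat.zero_le _) (rep := Fin.elim0)
    (fun j => j.elim0) fun t => (hP t).choose.elim0⟩

theorem sum_area_le_of_cover {ι : Type*} [Fintype ι] {K : ι → Rect} {a : ι → ℝ}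
    (hw : ∀ i, 0 < (K i).width) (hh : ∀ i, 0 < (K i).height)
    (ha : ∀ i, 0 ≤ a i ∧ a i + (K i).height ≤ 1) {W : ℝ} (hW : 0 ≤ W)
    (hcov : ∀ y, ∑ i with y ∈ Ioo (a i) (a i + (K i).height), (K i).width ≤ W) :
    ∑ i, (K i).width * (K i).height ≤ W :=
  sum_mul_le_of_cover (fun i _ => lt_add_of_pos_right (a i) (hh i)) (fun i _ => (hw i).le) hW hcov
    fun c _ hc => by
      simpa only [add_sub_cancel_left] using
        sum_length_le_one (fun i _ => lt_add_of_pos_right (a i) (hh i)) (fun i _ => ha i) hc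

theorem mul_sum_width_le_sum_area {ι : Type*} [Fintype ι] {δ : ℝ} {K : ι → Rect}
    (hw : ∀ i, 0 < (K i).width) (hh : ∀ i, 0 < (K i).height) :
    δ * ∑ i with δ < (K i).height, (K i).width ≤ ∑ i, (K i).width * (K i).height :=
  calc δ * ∑ i with δ < (K i).height, (K i).width
      ≤ ∑ i with δ < (K i).height, (K i).width * (K i).height := by
        rw [Finset.mul_sum]
        refine Finset.sum_le_sum fun i hi => ?_
        rw [mul_comm]
        exact mul_le_mul_of_nonneg_left (Finset.mem_filter.1 hi).2.le (hw i).le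
    _ ≤ ∑ i, (K i).width * (K i).height :=
        Finset.sum_le_univ_sum_of_nonneg fun i => (mul_pos (hw i) (hh i)).le

theorem div_ceil_one_div_sq_le {δ Ω W : ℝ} (hδ : 0 < δ) (hΩ : 0 ≤ Ω) (h : δ * Ω ≤ W) :
    Ω / ⌈1 / δ ^ 2⌉₊ ≤ δ * W :=
  calc Ω / ⌈1 / δ ^ 2⌉₊ ≤ Ω / (1 / δ ^ 2) :=
        div_le_div_of_nonneg_left hΩ (by positivity) (Nat.le_ceil _)
    _ = δ * (δ * Ω) := by field_simp
    _ ≤ δ * W := mul_le_mul_of_nonneg_left h hδ.le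

theorem ceil_add_sum_ceil_lt {κ : Type*} [Fintype κ] {g : ℝ} (hg : 0 ≤ g) {y : κ → ℝ}
    (hy : ∀ k, 0 ≤ y k) :
    ((⌈g⌉₊ + ∑ k, ⌈y k⌉₊ : ℕ) : ℝ) < g + 1 + (∑ k, y k + Fintype.card κ) := by
  have hsum : ∑ k, (⌈y k⌉₊ : ℝ) ≤ ∑ k, y k + Fintype.card κ :=
    calc ∑ k, (⌈y k⌉₊ : ℝ) ≤ ∑ k, (y k + 1) :=
          Finset.sum_le_sum fun k _ => (Nat.ceil_lt_add_one (hy k)).le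
      _ = ∑ k, y k + Fintype.card κ := by simp [Finset.sum_add_distrib]
  push_cast
  exact add_lt_add_of_lt_of_le (Nat.ceil_lt_add_one hg) hsum

theorem exists_structured_packing {ι : Type*} [Fintype ι] {δ : ℝ} (hδ : 0 < δ) {K : ι → Rect}
    {a : ι → ℝ} (hw : ∀ i, 0 < (K i).width) (hh : ∀ i, 0 < (K i).height)
    (ha : ∀ i, 0 ≤ a i ∧ a i + (K i).height ≤ 1) {W : ℝ} (hW : 0 ≤ W)
    (hcov : ∀ y, ∑ i with y ∈ Ioo (a i) (a i + (K i).height), (K i).width ≤ W) :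
    ∃ (N : ℕ) (P : ShelfPacking δ K N), P.IsStructured ∧
      (N : ℝ) < W * (1 + δ) + ⌈1 / δ ^ 2⌉₊ + 1 + δ := by
  have harea := sum_area_le_of_cover hw hh ha hW hcov
  set L := Finset.univ.filter fun i => δ < (K i).height
  rcases L.eq_empty_or_nonempty with hempty | hne
  · have hsmall i : (K i).height ≤ δ := not_lt.1 (Finset.filter_eq_empty_iff.1 hempty (by simp))
    obtain ⟨P, hP⟩ := exists_structured_packing_of_small hw (fun i => ⟨hh i, hsmall i⟩)
      (N := ⌊W⌋₊ + 1) (by exact_mod_cast harea.trans_lt (Nat.lt_floor_add_one W))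
    refine ⟨_, P, hP, ?_⟩
    have := Nat.floor_le hW
    push_cast
    linarith [mul_nonneg hW hδ.le, (⌈1 / δ ^ 2⌉₊).cast_nonneg (α := ℝ)]
  obtain ⟨r, hr⟩ : ∃ r, ⌈1 / δ ^ 2⌉₊ = r + 1 :=
    Nat.exists_eq_add_one_of_ne_zero (Nat.ceil_pos.2 (by positivity)).ne'
  have hΩ : 0 < ∑ i ∈ L, (K i).width := Finset.sum_pos (fun i _ => hw i) hne
  obtain ⟨G⟩ := exists_linearGrouping hne (fun i _ => hw i) (fun i => (K i).height) r
  have hcovL y : ∑ i ∈ L with y ∈ Ioo (a i) (a i + (K i).height), (K i).width ≤ W + δ :=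
    calc _ ≤ ∑ i with y ∈ Ioo (a i) (a i + (K i).height), (K i).width :=
          Finset.sum_le_sum_of_subset_of_nonneg
            (Finset.filter_subset_filter _ (Finset.subset_univ L)) fun i _ _ => (hw i).le
      _ ≤ W + δ := (hcov y).trans (le_add_of_nonneg_right hδ.le)
  obtain ⟨κ, _, n, y, hcard, hn, hy0, hysum, hy⟩ :=
    G.exists_configurations (fun i _ => hh i) (fun i _ => ha i) (by positivity) hcovL
  obtain ⟨P, hP⟩ := G.exists_shelfPacking hw (fun i => ⟨hh i, by linarith [ha i]⟩)
    (by positivity) hn hy (by linarith)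
  refine ⟨_, P, P.isStructured_of_forall_exists hr.ge
    (fun j => (Finset.mem_filter.1 (G.rep_mem j)).2) hP, ?_⟩
  have hg := div_ceil_one_div_sq_le hδ hΩ.le
    ((mul_sum_width_le_sum_area hw hh).trans harea)
  have hN := ceil_add_sum_ceil_lt (g := (∑ i ∈ L, (K i).width) / (r + 1)) (by positivity)
    fun k => (hy0 k).le
  have hcard' : (Fintype.card κ : ℝ) ≤ r + 1 := by exact_mod_cast hcard
  rw [hr] at hg ⊢
  push_cast at hg hN ⊢
  linarith

theorem mainTheorem3_general {ι : Type*} [Finite ι] {b : ℕ} {δ : ℝ} (hδ : 0 < δ)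
    {len : ι → Fin (b + 1) → ℝ} (hlen : ∀ i j, len i j ∈ Ioc (0 : ℝ) 1) {g : ℝ → ℝ} {T : ℝ}
    (hT : 0 < T) (hg : IsWeightingFunction fun x => g x / T)
    (hg0 : ∀ x ∈ Ioc (0 : ℝ) 1, 0 < g x) :
    (∃ (N : ℕ) (P : ShelfPacking δ
        (fun i => ⟨∏ j : Fin b, g (len i j.castSucc), len i (Fin.last b)⟩) N), P.IsStructured) ∧
      (sopt δ (fun i => ⟨∏ j : Fin b, g (len i j.castSucc), len i (Fin.last b)⟩) : ℝ) <
        T ^ b * (1 + δ) * optBP len + ⌈1 / δ ^ 2⌉₊ + 1 + δ := by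
  cases nonempty_fintype ι
  obtain ⟨P⟩ : Nonempty (BoxPacking len (optBP len)) := Nat.sInf_mem (boxPacking_exists len hlen)
  obtain ⟨N, Q, hQ, hN⟩ := exists_structured_packing hδ
    (K := fun i => ⟨∏ j : Fin b, g (len i j.castSucc), len i (Fin.last b)⟩)
    (fun i => Finset.prod_pos (s := Finset.univ) fun j _ => hg0 _ (hlen i (Fin.castSucc j)))
    (fun i => (hlen i _).1) (fun i => P.inside i (Fin.last b)) (by positivity)
    (P.sum_prod_le hlen hT hg)
  refine ⟨⟨N, Q, hQ⟩, ?_⟩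
  have hsopt : sopt δ _ ≤ N := Nat.sInf_le ⟨Q, hQ⟩
  calc _ ≤ (N : ℝ) := Nat.cast_le.2 hsopt
    _ < _ := hN
    _ = _ := by ring

theorem mainTheorem3 {ι : Type*} [Fintype ι] (b : ℕ) (hb : 1 ≤ b) (k : ℕ) (hk : 3 ≤ k)
    (δ : ℝ) (hδ : δ ∈ Set.Ioo (0 : ℝ) 1)
    (len : ι → Fin (b + 1) → ℝ) (hlen : ∀ i j, len i j ∈ Set.Ioc (0 : ℝ) 1) :
    (∃ (N : ℕ) (P : ShelfPacking δ (fun i => roundBox k (len i)) N), P.IsStructured) ∧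
      (sopt δ (fun i => roundBox k (len i)) : ℝ) <
        harmonicConst k ^ b * (1 + δ) * (optBP len : ℝ) + (⌈1 / δ ^ 2⌉₊ : ℝ) + 1 + δ :=
  mainTheorem3_general hδ.1 hlen (harmonicConst_isLeast hk).1.1 (harmonicConst_isLeast hk).1.2
    fun _ => harmonicFn_pos hk
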